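/- Let $\Omega$ be $\mathbb{CP}^1\times\mathbb{CP}^1$ with two lines identified by $([1,0],[t_1,t_2])\sim([t_1,t_2],[0,1])$. **Data.** Fix $B,\Lambda,\tilde c_1,\tilde c_2\in\mathbb C^*$ and a function $$g(z_1,z_2,w_1,w_2)=\alpha z_1w_1+\beta z_1w_2+\gamma z_2w_1+\delta z_2w_2,\qquad \alpha,\beta,\gamma,\delta\in\mathbb C,$$ with $g(0,1,0,1)\neq0$ and $g(1,0,t_1,t_2)-B\,g(t_1,t_2,0,1)=0$ for all $t_1,t_2$. For $i=1,2$ let $G_i(\,\cdot\,,s)$, $s\in\mathbb C$, be a family of functions of the same form (with coefficients depending on $s$, complex differentiable at $s=0$) such that $$G_i(1,0,t_1,t_2,s)-Be^{s}\,G_i(t_1,t_2,0,1,s)=0\quad\text{for all } s,t_1,t_2,\qquad G_i(\,\cdot\,,0)=g,$$ and such that the three functions $g,\ \partial_sG_1(\,\cdot\,,0),\ \partial_sG_2(\,\cdot\,,0)$ are linearly independent. For $h=(h_1,h_2)\in(\mathbb C^*)^2$ put $g_i(P)=G_i(P,\tilde c_ih_i)$ and $c_i=Be^{\tilde c_ih_i}$;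 thus $g_i(1,0,t_1,t_2)-c_i\,g_i(t_1,t_2,0,1)=0$. **Difference operators.** Let $\mathcal K$ be the field of rational functions of $e^{\tilde c_1x_1+\tilde c_2x_2}$ with complex coefficients. For $f\in\mathcal K$ let $\hat f:\mathbb Z^2\to\mathcal K$ be $\hat f(n)=f(x+nh)$, where $nh=(n_1h_1,n_2h_2)$, and let $\hat{\mathcal K}=\{\hat f: f\in\mathcal K\}$. Let $\mathcal T_2=\hat{\mathcal K}[T_1,T_2]$ be the ring of difference operators, acting on functions $\varphi(n,P)$ of $n\in\mathbb Z^2$ whose values are rational functions of $P=(z_1,z_2,w_1,w_2)$ with coefficients in $\mathcal K$; here $T_i$ is the shift $\varphi(n,P)\mapsto\varphi(n+e_i,P)$. **The module.** Let $\hat M_{\Omega,\Lambda}=\bigcup_{k\ge0}\hat M_{\Omega,\Lambda}(k)$, where $\hat M_{\Omega,\Lambda}(k)$ is the set of all functions $$\varphi(n,P)=\frac{\tilde h(n,P)}{g(P)^k}\prod_{j=1}^2\left(\frac{g_j(P)}{g(P)}\right)^{n_j},\qquad \tilde h(n,P)=\sum_{0\le i,j\le k}\hat a_{ij}(n)\,z_1^iz_2^{k-i}w_1^jw_2^{k-j},\quad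 \hat a_{ij}\in\hat{\mathcal K},$$ that satisfy, for all $n\in\mathbb Z^2$, $$\varphi(n,1,0,t_1,t_2)-\Lambda e^{-\tilde c_1x_1-\tilde c_2x_2}\,\varphi(n,t_1,t_2,0,1)=0 .$$ **Theorem.** For uncountably many $h\in(\mathbb C^*)^2$ (for which $g_i(0,1,0,1)\ne0$, $i=1,2$, so that the products $\prod_j(g_j/g)^{n_j}$ can be restricted to the two identified lines), $\hat M_{\Omega,\Lambda}$ is a $\mathcal T_2$-module which is free of rank 2, with a basis consisting of two functions from $\hat M_{\Omega,\Lambda}(1)$. -/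

import Mathlib

noncomputable section

namespace DBA

/-- The coefficient field `𝒦`: rational functions over `ℂ` of the single quantity
`y = exp (c₁ x₁ + c₂ x₂)`. As `(c₁, c₂) ≠ 0`, this exponential is transcendental over `ℂ`, and `y` is
represented by `RatFunc.X`. -/
abbrev Coeff : Type := RatFunc ℂ

theorem scale_injective (a : ℂ) : Function.Injective
    (Polynomial.aeval (R := ℂ) (RatFunc.C (Complex.exp a) * RatFunc.X : Coeff)) := by
  have h : (Polynomial.aeval (R := ℂ) (RatFunc.C (Complex.exp a) * RatFunc.X : Coeff)) =
      (Algebra.algHom ℂ (Polynomial ℂ) Coeff).comp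
        (Polynomial.aeval (Polynomial.C (Complex.exp a) * Polynomial.X)) := by
    ext
    simp [Algebra.algHom]
  rw [h]
  refine (RatFunc.algebraMap_injective ℂ).comp ?_
  have h2 : (Polynomial.aeval (Polynomial.C (Complex.exp (-a)) * Polynomial.X)).comp
      (Polynomial.aeval (Polynomial.C (Complex.exp a) * Polynomial.X)) =
      AlgHom.id ℂ (Polynomial ℂ) := by
    ext1
    simp [← mul_assoc, ← Polynomial.C_mul, ← Complex.exp_add, Polynomial.algebraMap_eq]
  exact Function.LeftInverse.injective (fun p => DFunLike.congr_fun h2 p)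

/-- The substitution `y ↦ exp a · y` on `𝒦`. The translation `x ↦ x + v` of the variables
acts on `𝒦` by this substitution with `a = c₁ v₁ + c₂ v₂`. -/
def scale (a : ℂ) : Coeff →ₐ[ℂ] Coeff :=
  RatFunc.liftAlgHom (Polynomial.aeval (RatFunc.C (Complex.exp a) * RatFunc.X))
    (nonZeroDivisors_le_comap_nonZeroDivisors_of_injective _ (scale_injective a))

/-- The discrete function `f̂ : ℤ² → 𝒦`, `f̂(n) = f(x + n h)`, where `n h = (n₁ h₁, n₂ h₂)`. -/
def disc (c h : Fin 2 → ℂ) (f : Coeff) (n : Fin 2 → ℤ) : Coeff :=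
  scale (∑ i, c i * (n i * h i)) f

/-- The value at `(z₁, z₂, w₁, w₂)` of the function
`α z₁ w₁ + β z₁ w₂ + γ z₂ w₁ + δ z₂ w₂` with `(α, β, γ, δ) = p`. -/
def bil {R : Type} [CommRing R] [Algebra ℂ R] (p : Fin 4 → ℂ) (z₁ z₂ w₁ w₂ : R) : R :=
  algebraMap ℂ R (p 0) * (z₁ * w₁) + algebraMap ℂ R (p 1) * (z₁ * w₂) +
    algebraMap ℂ R (p 2) * (z₂ * w₁) + algebraMap ℂ R (p 3) * (z₂ * w₂)

/-- The value at `(z₁, z₂, w₁, w₂)` of the form `∑ aᵢⱼ z₁ⁱ z₂ᵏ⁻ⁱ w₁ʲ w₂ᵏ⁻ʲ` (`0 ≤ i, j ≤ k`). -/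
def biform {R : Type} [CommRing R] [Algebra Coeff R] (k : ℕ)
    (a : Fin (k + 1) → Fin (k + 1) → Coeff) (z₁ z₂ w₁ w₂ : R) : R :=
  ∑ i : Fin (k + 1), ∑ j : Fin (k + 1), algebraMap Coeff R (a i j) *
    (z₁ ^ (i : ℕ) * z₂ ^ (k - (i : ℕ)) * w₁ ^ (j : ℕ) * w₂ ^ (k - (j : ℕ)))

/-- The field of rational functions of `P = (z₁, z₂, w₁, w₂)` with coefficients in `𝒦`. -/
abbrev RatP : Type := FractionRing (MvPolynomial (Fin 4) Coeff)

/-- The field of rational functions of `(t₁, t₂)` with coefficients in `𝒦`. -/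
abbrev RatT : Type := FractionRing (MvPolynomial (Fin 2) Coeff)

/-- The coordinates of `P`. -/
def zw (i : Fin 4) : RatP := algebraMap (MvPolynomial (Fin 4) Coeff) RatP (MvPolynomial.X i)

/-- The coordinates `t₁, t₂`. -/
def tt (i : Fin 2) : RatT := algebraMap (MvPolynomial (Fin 2) Coeff) RatT (MvPolynomial.X i)

/-- The value at `n` and `(z₁, z₂, w₁, w₂)` of the function
`h̃(n, P) / g(P)ᵏ · (g₁(P) / g(P))^{n₁} · (g₂(P) / g(P))^{n₂}`, where `h̃(n, P)` is the form of
bidegree `(k, k)` with coefficients `âᵢⱼ(n)`. -/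
def baValue {L : Type} [Field L] [Algebra ℂ L] [Algebra Coeff L] (c h : Fin 2 → ℂ)
    (g : Fin 4 → ℂ) (G : Fin 2 → Fin 4 → ℂ) (k : ℕ) (a : Fin (k + 1) → Fin (k + 1) → Coeff)
    (n : Fin 2 → ℤ) (z₁ z₂ w₁ w₂ : L) : L :=
  biform k (fun i j => disc c h (a i j) n) z₁ z₂ w₁ w₂ / bil g z₁ z₂ w₁ w₂ ^ k *
    ∏ j, (bil (G j) z₁ z₂ w₁ w₂ / bil g z₁ z₂ w₁ w₂) ^ n j

/-- The space of all functions of `n ∈ ℤ²` with values in the rational functions of `P`. -/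
abbrev DFun : Type := (Fin 2 → ℤ) → RatP

/-- The `k`-th piece of the discrete Baker-Akhiezer module: all functions
`φ(n, P) = h̃(n, P) / g(P)ᵏ · ∏ⱼ (gⱼ(P) / g(P))^{nⱼ}` with
`φ(n, 1, 0, t₁, t₂) = Λ exp (-(c₁ x₁ + c₂ x₂)) φ(n, t₁, t₂, 0, 1)`. -/
def modulePiece (Λ : ℂ) (c h : Fin 2 → ℂ) (g : Fin 4 → ℂ) (G : Fin 2 → Fin 4 → ℂ) (k : ℕ) :
    Set DFun :=
  {φ | ∃ a : Fin (k + 1) → Fin (k + 1) → Coeff,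
    (∀ n, φ n = baValue c h g G k a n (zw 0) (zw 1) (zw 2) (zw 3)) ∧
    ∀ n, baValue c h g G k a n (1 : RatT) 0 (tt 0) (tt 1) =
      algebraMap Coeff RatT (RatFunc.C Λ * RatFunc.X⁻¹) *
        baValue c h g G k a n (tt 0) (tt 1) (0 : RatT) 1}

/-- The shift operator `(Tᵢ φ)(n) = φ(n + eᵢ)`. -/
def shift (i : Fin 2) : Module.End ℂ DFun :=
  LinearMap.funLeft ℂ RatP (fun n : Fin 2 → ℤ => n + Pi.single i 1)

/-- The operator of multiplication by the discrete function `f̂`. -/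
def mulDisc (c h : Fin 2 → ℂ) (f : Coeff) : Module.End ℂ DFun :=
  LinearMap.mulLeft ℂ (fun n : Fin 2 → ℤ => algebraMap Coeff RatP (disc c h f n))

/-- The ring `𝒯₂ = 𝒦̂[T₁, T₂]` of difference operators, as operators on functions of `n`. -/
def diffOps (c h : Fin 2 → ℂ) : Subalgebra ℂ (Module.End ℂ DFun) :=
  Algebra.adjoin ℂ (Set.range (mulDisc c h) ∪ Set.range shift)

/-- The discrete Baker-Akhiezer module, the union of the sets `modulePiece Λ c h g G k`,
is a free module of rank two over the ring of difference operators, with a basis of two functions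
from the piece `k = 1`. -/
def FreeOfRankTwo (Λ : ℂ) (c h : Fin 2 → ℂ) (g : Fin 4 → ℂ) (G : Fin 2 → Fin 4 → ℂ) : Prop :=
  ∃ M : Submodule (diffOps c h) DFun,
    (M : Set DFun) = ⋃ k : ℕ, modulePiece Λ c h g G k ∧
    ∃ b : Module.Basis (Fin 2) (diffOps c h) M, ∀ i, (b i : DFun) ∈ modulePiece Λ c h g G 1

end DBA

end

noncomputable section

namespace DBA

open MvPolynomial (aeval)
open Filter Topology

/-! Write `y` for the exponential generating `𝒦`. Clearing the denominators and the powers of `gⱼ /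
g` identifies the `k`-th piece of the module with the forms of bidegree `(k, k)` whose restrictions
to the two lines have ratio `Λ Bᵏ y⁻¹` (`modulePiece_eq`). The proof is then a dimension count.

Gluing expresses the top row of coefficients by the first column, so in bidegree `(k + 1, k + 1)`
the dimension is at most `(k + 1)(k + 2)` (`finrank_gluedForms_le`). The translates `T^m`, `|m| ≤
k`, of two elements of the first piece, padded by powers of `g`, lie in this space, and there are
exactly `(k + 1)(k + 2)` of them. If they are linearly independent, they form a basis for every `k`,
and this is freeness of rank two.

Independence over `ℂ(y)` follows from independence over `ℂ` at `y = 0` (`family_linearIndepOn`).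
There the generators become multiples of `z₁ w₁` and `z₂ w₁`, so it remains to see that `z₁` and
`z₂` satisfy no relation over the polynomials in `g, g₁, g₂` (`eq_zero_of_forall_bil`). These three
forms are the projection of the Segre quadric in `P³` from the point `v` where they vanish. If `v`
is off the quadric, a general fibre consists of two points with distinct `[z₁ : z₂]`, and two values
of the relation force both coefficients to vanish.

Finally `v` is off the quadric for `h = (t / c₁, t / c₂)` with small `t ≠ 0`: after division by `t⁴`
the obstruction tends to its value at `g, ∂G₁, ∂G₂`, which is nonzero by linear independence
(`quad_cross_ne_zero`). -/

/-! ### Substitutions in the coefficient field -/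

theorem scale_algebraMap (a : ℂ) (p : Polynomial ℂ) :
    scale a (algebraMap (Polynomial ℂ) Coeff p) =
      Polynomial.aeval (RatFunc.C (Complex.exp a) * RatFunc.X : Coeff) p := by
  simp only [scale]
  have := RatFunc.liftAlgHom_apply_div (Polynomial.aeval (R := ℂ) (RatFunc.C (Complex.exp a) * RatFunc.X : Coeff))
    (nonZeroDivisors_le_comap_nonZeroDivisors_of_injective _ (scale_injective a)) p 1
  simpa using this

@[simp] theorem scale_X (a : ℂ) :
    scale a RatFunc.X = RatFunc.C (Complex.exp a) * RatFunc.X := by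
  rw [← RatFunc.algebraMap_X, scale_algebraMap, Polynomial.aeval_X, RatFunc.algebraMap_X]

@[simp] theorem scale_C (a z : ℂ) : scale a (RatFunc.C z) = RatFunc.C z :=
  (scale a).commutes z

theorem coeff_algHom_ext {f g : Coeff →ₐ[ℂ] Coeff} (h : f RatFunc.X = g RatFunc.X) : f = g := by
  refine IsLocalization.algHom_ext (nonZeroDivisors (Polynomial ℂ)) ?_
  ext
  simpa [Algebra.algHom] using h

theorem scale_zero : scale 0 = AlgHom.id ℂ Coeff := coeff_algHom_ext (by simp)

theorem scale_add (a b : ℂ) : scale (a + b) = (scale a).comp (scale b) :=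
  coeff_algHom_ext (by simp [Complex.exp_add]; ring)

theorem scale_scale (a b : ℂ) (f : Coeff) : scale a (scale b f) = scale (a + b) f := by
  rw [scale_add]; rfl

/-- The exponent `∑ cᵢ vᵢ hᵢ` for which the translation of `n` by `v` acts on `𝒦` by `scale`. -/
def expo (c h : Fin 2 → ℂ) (v : Fin 2 → ℤ) : ℂ := ∑ i, c i * (v i * h i)

theorem disc_eq (c h : Fin 2 → ℂ) (f : Coeff) (n : Fin 2 → ℤ) :
    disc c h f n = scale (expo c h n) f := rfl

theorem expo_add (c h : Fin 2 → ℂ) (v w : Fin 2 → ℤ) :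
    expo c h (v + w) = expo c h v + expo c h w := by
  simp [expo]; ring

@[simp] theorem expo_zero (c h : Fin 2 → ℂ) : expo c h 0 = 0 := by simp [expo]

/-- The substitution `y ↦ exp a · y` in the coefficients of a polynomial. -/
def twist {σ : Type} (a : ℂ) : MvPolynomial σ Coeff →ₐ[ℂ] MvPolynomial σ Coeff :=
  MvPolynomial.mapAlgHom (scale a)

@[simp] theorem twist_C {σ : Type} (a : ℂ) (f : Coeff) :
    twist a (MvPolynomial.C f : MvPolynomial σ Coeff) = MvPolynomial.C (scale a f) := by
  simp [twist]

@[simp] theorem twist_X {σ : Type} (a : ℂ) (i : σ) :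
    twist a (MvPolynomial.X i : MvPolynomial σ Coeff) = MvPolynomial.X i := by
  simp [twist]

theorem twist_twist {σ : Type} (a b : ℂ) (F : MvPolynomial σ Coeff) :
    twist a (twist b F) = twist (a + b) F := by
  induction F using MvPolynomial.induction_on with
  | C f => simp [scale_scale]
  | add p q hp hq => simp [hp, hq]
  | mul_X p i hp => simp [hp]

@[simp] theorem twist_zero {σ : Type} (F : MvPolynomial σ Coeff) : twist 0 F = F := by
  induction F using MvPolynomial.induction_on with
  | C f => simp [scale_zero]
  | add p q hp hq => simp [hp, hq]
  | mul_X p i hp => simp [hp]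

theorem map_bil {R S : Type} [CommRing R] [CommRing S] [Algebra ℂ R] [Algebra ℂ S]
    (f : R →ₐ[ℂ] S) (p : Fin 4 → ℂ) (a b c d : R) :
    f (bil p a b c d) = bil p (f a) (f b) (f c) (f d) := by
  simp [bil]

/-! ### Glued forms and their products -/

/-- Polynomials in `(z₁, z₂, w₁, w₂)` with coefficients in `𝒦`. -/
abbrev Forms : Type := MvPolynomial (Fin 4) Coeff

/-- Polynomials in `(t₁, t₂)` with coefficients in `𝒦`. -/
abbrev LineForms : Type := MvPolynomial (Fin 2) Coeff

/-- The polynomial with value `bil p`. -/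
def bilForm (p : Fin 4 → ℂ) : Forms :=
  bil p (MvPolynomial.X 0) (MvPolynomial.X 1) (MvPolynomial.X 2) (MvPolynomial.X 3)

/-- The polynomial with value `biform k a`, as a linear map in the coefficients. -/
def biformHom (k : ℕ) : (Fin (k + 1) → Fin (k + 1) → Coeff) →ₗ[Coeff] Forms where
  toFun a := biform k a (MvPolynomial.X 0) (MvPolynomial.X 1) (MvPolynomial.X 2) (MvPolynomial.X 3)
  map_add' a b := by
    simp [biform, add_mul, Finset.sum_add_distrib]
  map_smul' r a := by
    simp [biform, mul_assoc, Finset.mul_sum, Algebra.smul_def]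

/-- Restriction to the line `([1, 0], [t₁, t₂])`. -/
def resZ : Forms →ₐ[Coeff] LineForms :=
  aeval ![1, 0, MvPolynomial.X 0, MvPolynomial.X 1]

/-- Restriction to the line `([t₁, t₂], [0, 1])`. -/
def resW : Forms →ₐ[Coeff] LineForms :=
  aeval ![MvPolynomial.X 0, MvPolynomial.X 1, 0, 1]

theorem twist_resZ (a : ℂ) (F : Forms) : twist a (resZ F) = resZ (twist a F) := by
  induction F using MvPolynomial.induction_on with
  | C f => simp [resZ, MvPolynomial.algebraMap_eq]
  | add p q hp hq => simp [hp, hq]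
  | mul_X p i hp =>
    simp only [map_mul, hp, twist_X]
    fin_cases i <;> simp [resZ]

theorem twist_resW (a : ℂ) (F : Forms) : twist a (resW F) = resW (twist a F) := by
  induction F using MvPolynomial.induction_on with
  | C f => simp [resW, MvPolynomial.algebraMap_eq]
  | add p q hp hq => simp [hp, hq]
  | mul_X p i hp =>
    simp only [map_mul, hp, twist_X]
    fin_cases i <;> simp [resW]

@[simp] theorem twist_bilForm (a : ℂ) (p : Fin 4 → ℂ) : twist a (bilForm p) = bilForm p := by
  simp [bilForm, map_bil]

/-- Forms of bidegree `(k, k)` whose restrictions to the two lines have ratio `μ`. -/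
def gluedForms (μ : Coeff) (k : ℕ) : Submodule Coeff Forms :=
  LinearMap.range (biformHom k) ⊓ LinearMap.eqLocus resZ.toLinearMap (μ • resW.toLinearMap)

theorem mem_gluedForms {μ : Coeff} {k : ℕ} {F : Forms} :
    F ∈ gluedForms μ k ↔ (∃ a, biformHom k a = F) ∧ resZ F = μ • resW F := by
  simp [gluedForms]

theorem biformHom_mul_bilForm (k : ℕ) (a : Fin (k + 1) → Fin (k + 1) → Coeff) (p : Fin 4 → ℂ) :
    biformHom k a * bilForm p ∈ LinearMap.range (biformHom (k + 1)) := by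
  have hmon : ∀ i j : Fin (k + 2), (MvPolynomial.X 0 ^ (i : ℕ) * MvPolynomial.X 1 ^ (k + 1 - (i : ℕ)) *
      MvPolynomial.X 2 ^ (j : ℕ) * MvPolynomial.X 3 ^ (k + 1 - (j : ℕ)) : Forms) ∈
        LinearMap.range (biformHom (k + 1)) := by
    intro i j
    refine ⟨Pi.single i (Pi.single j 1), ?_⟩
    simp only [biformHom, biform, LinearMap.coe_mk, AddHom.coe_mk]
    rw [Finset.sum_eq_single i, Finset.sum_eq_single j]
    · simp
    · intro b _ hb; simp [hb]
    · simp
    · intro b _ hb; simp [hb]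
    · simp
  simp only [biformHom, biform, LinearMap.coe_mk, AddHom.coe_mk, Finset.sum_mul]
  refine Submodule.sum_mem _ fun i _ => Submodule.sum_mem _ fun j _ => ?_
  have hi : k + 1 - (i : ℕ) = k - i + 1 := by omega
  have hj : k + 1 - (j : ℕ) = k - j + 1 := by omega
  -- Multiplying by `z₁` raises `i` and by `z₂` keeps it; `w₁` and `w₂` act on `j` in the same way.
  have h00 := hmon i.succ j.succ
  have h01 := hmon i.succ j.castSucc
  have h10 := hmon i.castSucc j.succ
  have h11 := hmon i.castSucc j.castSucc
  simp only [Fin.val_succ, Fin.val_castSucc, hi, hj, Nat.add_sub_add_right] at h00 h01 h10 h11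
  have key := Submodule.smul_mem _ (a i j) (Submodule.add_mem _ (Submodule.add_mem _ (Submodule.add_mem _
    (Submodule.smul_mem _ (algebraMap ℂ Coeff (p 0)) h00)
    (Submodule.smul_mem _ (algebraMap ℂ Coeff (p 1)) h01))
    (Submodule.smul_mem _ (algebraMap ℂ Coeff (p 2)) h10))
    (Submodule.smul_mem _ (algebraMap ℂ Coeff (p 3)) h11))
  refine (congrArg (· ∈ LinearMap.range (biformHom (k + 1))) ?_).mpr key
  simp only [bilForm, bil, Algebra.smul_def, ← IsScalarTower.algebraMap_apply ℂ Coeff Forms]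
  ring

theorem biformHom_twist (k : ℕ) (a : Fin (k + 1) → Fin (k + 1) → Coeff) (b : ℂ) :
    twist b (biformHom k a) = biformHom k fun i j => scale b (a i j) := by
  simp only [biformHom, biform, LinearMap.coe_mk, AddHom.coe_mk, MvPolynomial.algebraMap_eq,
    map_sum, map_mul, map_pow, twist_C, twist_X]

theorem gluedForms_mul_bilForm {μ : Coeff} {k : ℕ} {F : Forms} {p : Fin 4 → ℂ} {b : ℂ}
    (hF : F ∈ gluedForms μ k) (hp : resZ (bilForm p) = RatFunc.C b • resW (bilForm p)) :
    F * bilForm p ∈ gluedForms (μ * RatFunc.C b) (k + 1) := by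
  rw [mem_gluedForms] at hF ⊢
  obtain ⟨⟨a, rfl⟩, h⟩ := hF
  refine ⟨biformHom_mul_bilForm k a p, ?_⟩
  rw [map_mul, map_mul, h, hp, smul_mul_smul_comm]

theorem gluedForms_mul_bilForm_pow {μ : Coeff} {k : ℕ} {F : Forms} {p : Fin 4 → ℂ} {b : ℂ}
    (hF : F ∈ gluedForms μ k) (hp : resZ (bilForm p) = RatFunc.C b • resW (bilForm p)) (e : ℕ) :
    F * bilForm p ^ e ∈ gluedForms (μ * RatFunc.C b ^ e) (k + e) := by
  induction e with
  | zero => simpa using hF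
  | succ e ih =>
    have := gluedForms_mul_bilForm ih hp
    rwa [mul_assoc, ← pow_succ, mul_assoc, ← pow_succ] at this

theorem gluedForms_twist {μ : Coeff} {k : ℕ} {F : Forms} (b : ℂ) (hF : F ∈ gluedForms μ k) :
    twist b F ∈ gluedForms (scale b μ) k := by
  rw [mem_gluedForms] at hF ⊢
  obtain ⟨⟨a, rfl⟩, h⟩ := hF
  refine ⟨⟨_, (biformHom_twist k a b).symm⟩, ?_⟩
  rw [← twist_resZ, h, ← twist_resW]
  simp [Algebra.smul_def, MvPolynomial.algebraMap_eq]

/-! ### Coefficients of glued forms and the dimension bound -/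

theorem resZ_biformHom (k : ℕ) (a : Fin (k + 1) → Fin (k + 1) → Coeff) :
    resZ (biformHom k a) = ∑ j : Fin (k + 1), MvPolynomial.C (a (Fin.last k) j) *
      (MvPolynomial.X 0 ^ (j : ℕ) * MvPolynomial.X 1 ^ (k - (j : ℕ))) := by
  simp only [biformHom, biform, LinearMap.coe_mk, AddHom.coe_mk, map_sum]
  rw [Finset.sum_eq_single (Fin.last k)]
  · simp [resZ, MvPolynomial.algebraMap_eq]
  · intro b _ hb
    have : k - (b : ℕ) ≠ 0 := by
      have := Fin.val_lt_last hb
      omega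
    simp [resZ, this]
  · simp

theorem resW_biformHom (k : ℕ) (a : Fin (k + 1) → Fin (k + 1) → Coeff) :
    resW (biformHom k a) = ∑ i : Fin (k + 1), MvPolynomial.C (a i 0) *
      (MvPolynomial.X 0 ^ (i : ℕ) * MvPolynomial.X 1 ^ (k - (i : ℕ))) := by
  simp only [biformHom, biform, LinearMap.coe_mk, AddHom.coe_mk, map_sum]
  refine Finset.sum_congr rfl fun i _ => ?_
  rw [Finset.sum_eq_single 0]
  · simp [resW, MvPolynomial.algebraMap_eq]
  · intro b _ hb
    have : (b : ℕ) ≠ 0 := fun h => hb (Fin.ext h)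
    simp [resW, this]
  · simp

theorem binaryForm_injective {k : ℕ} {a b : Fin (k + 1) → Coeff}
    (h : ∑ j : Fin (k + 1), (MvPolynomial.C (a j) *
      (MvPolynomial.X 0 ^ (j : ℕ) * MvPolynomial.X 1 ^ (k - (j : ℕ))) : LineForms) =
      ∑ j : Fin (k + 1), MvPolynomial.C (b j) *
      (MvPolynomial.X 0 ^ (j : ℕ) * MvPolynomial.X 1 ^ (k - (j : ℕ)))) (j : Fin (k + 1)) :
    a j = b j := by
  -- Dehomogenise by `t₂ = 1`; the exponent of `t₁` then identifies the coefficient.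
  have h2 := congrArg (aeval (R := Coeff) ![(Polynomial.X : Polynomial Coeff), 1]) h
  simp only [map_sum, map_mul, map_pow, MvPolynomial.aeval_X, MvPolynomial.aeval_C] at h2
  have h3 := congrArg (fun q => Polynomial.coeff q (j : ℕ)) h2
  simpa only [Matrix.cons_val_zero, Matrix.cons_val_one, one_pow, mul_one,
    Polynomial.algebraMap_eq, Polynomial.finsetSum_coeff, Polynomial.coeff_C_mul_X_pow, Fin.val_inj,
    Finset.sum_ite_eq, Finset.mem_univ, if_true] using h3

/-- On the first line `z₂ = 0` leaves only the row `i = k`, on the second `w₁ = 0` leaves only the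
column `j = 0`; the two binary forms are compared coefficientwise. -/
theorem glued_coeff {μ : Coeff} {k : ℕ} {a : Fin (k + 1) → Fin (k + 1) → Coeff}
    (h : biformHom k a ∈ gluedForms μ k) (j : Fin (k + 1)) : a (Fin.last k) j = μ * a j 0 := by
  rw [mem_gluedForms] at h
  have h := h.2
  rw [resZ_biformHom, resW_biformHom, Finset.smul_sum] at h
  refine binaryForm_injective (b := fun j => μ * a j 0) (h.trans ?_) j
  refine Finset.sum_congr rfl fun j _ => ?_
  rw [Algebra.smul_def, MvPolynomial.algebraMap_eq, map_mul, mul_assoc]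

/-- The space of glued forms of bidegree `(k + 1, k + 1)` has dimension at most
`(k + 1) (k + 2)`. -/
theorem finrank_gluedForms_le (μ : Coeff) (k : ℕ) :
    FiniteDimensional Coeff (gluedForms μ (k + 1)) ∧
    Module.finrank Coeff (gluedForms μ (k + 1)) ≤ (k + 1) * (k + 2) := by
  set V : Submodule Coeff (Fin (k + 2) → Fin (k + 2) → Coeff) :=
    (gluedForms μ (k + 1)).comap (biformHom (k + 1)) with hV
  have hmap : gluedForms μ (k + 1) = V.map (biformHom (k + 1)) := by
    rw [hV, Submodule.map_comap_eq, right_eq_inf]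
    exact inf_le_left
  -- Forgetting the last row leaves `(k + 1)(k + 2)` coefficients, which determine a glued form.
  let r : V →ₗ[Coeff] (Fin (k + 1) → Fin (k + 2) → Coeff) :=
    (LinearMap.funLeft Coeff (Fin (k + 2) → Coeff) Fin.castSucc).comp V.subtype
  have hr : Function.Injective r := by
    rw [injective_iff_map_eq_zero]
    rintro ⟨a, ha⟩ h0
    have h1 : ∀ i : Fin (k + 1), a i.castSucc = 0 := fun i => congrFun h0 i
    have hg := glued_coeff (k := k + 1) (a := a) (μ := μ) ha
    -- The corner lies in both the last row and the first column. It must vanish first, since the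
    -- entry `(last, last)` is `μ` times it.
    have hl0 : a (Fin.last (k + 1)) 0 = 0 := by
      rw [hg 0]
      have := h1 0
      simp only [Fin.castSucc_zero] at this
      simp [this]
    ext i j
    simp only [Submodule.coe_zero, Pi.zero_apply]
    refine Fin.lastCases ?_ (fun i => by rw [h1]; rfl) i
    rw [hg j]
    refine Fin.lastCases ?_ (fun j => by rw [h1]; simp) j
    rw [hl0, mul_zero]
  have h1 : Module.finrank Coeff V ≤ (k + 1) * (k + 2) := by
    refine (LinearMap.finrank_le_finrank_of_injective hr).trans ?_
    simp [Module.finrank_pi_fintype]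
  rw [hmap]
  exact ⟨inferInstance, (Submodule.finrank_map_le _ _).trans h1⟩

/-! ### Projection of the Segre quadric from a point outside it -/

/-- The generalised cross product of three vectors, annihilated by the linear form of each. -/
def cross (p q r : Fin 4 → ℂ) : Fin 4 → ℂ :=
  ![p 1 * (q 2 * r 3 - q 3 * r 2) - p 2 * (q 1 * r 3 - q 3 * r 1) + p 3 * (q 1 * r 2 - q 2 * r 1),
    -(p 0 * (q 2 * r 3 - q 3 * r 2) - p 2 * (q 0 * r 3 - q 3 * r 0) + p 3 * (q 0 * r 2 - q 2 * r 0)),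
    p 0 * (q 1 * r 3 - q 3 * r 1) - p 1 * (q 0 * r 3 - q 3 * r 0) + p 3 * (q 0 * r 1 - q 1 * r 0),
    -(p 0 * (q 1 * r 2 - q 2 * r 1) - p 1 * (q 0 * r 2 - q 2 * r 0) + p 2 * (q 0 * r 1 - q 1 * r 0))]

/-- The quadric of the decomposable tensors. -/
def quad (x : Fin 4 → ℂ) : ℂ := x 0 * x 3 - x 1 * x 2

/-- The linear form with coefficients `p`. -/
def lin (p x : Fin 4 → ℂ) : ℂ := p 0 * x 0 + p 1 * x 1 + p 2 * x 2 + p 3 * x 3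

theorem lin_cross (p q r : Fin 4 → ℂ) :
    lin p (cross p q r) = 0 ∧ lin q (cross p q r) = 0 ∧ lin r (cross p q r) = 0 := by
  refine ⟨?_, ?_, ?_⟩ <;> simp [lin, cross] <;> ring

/-- A nonzero cross product makes the three linear forms independent, hence jointly surjective;
`quad ≠ 0` also provides an explicit fourth form completing them. -/
theorem exists_lin_eq {p q r : Fin 4 → ℂ} (h : quad (cross p q r) ≠ 0) (u : Fin 3 → ℂ) :
    ∃ x, lin p x = u 0 ∧ lin q x = u 1 ∧ lin r x = u 2 := by
  set v := cross p q r with hv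
  -- The polar form of `quad` at `v`, so that its value at `v` is `2 * quad v`. The solution below
  -- is Cramer's rule for `p, q, r, d` with right-hand side `0` at `d`.
  let d : Fin 4 → ℂ := ![v 3, -v 2, -v 1, v 0]
  have hd : lin d v = 2 * quad v := by simp [lin, d, quad]; ring
  have hd0 : lin d v ≠ 0 := by rw [hd]; simpa using h
  refine ⟨fun i => (u 0 * cross d q r i - u 1 * cross d p r i + u 2 * cross d p q i) / (-lin d v),
    ?_, ?_, ?_⟩
  · have : lin p (fun i => (u 0 * cross d q r i - u 1 * cross d p r i + u 2 * cross d p q i) / (-lin d v))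
      = u 0 * (lin p (cross d q r) / (-lin d v)) - u 1 * (lin p (cross d p r) / (-lin d v)) +
        u 2 * (lin p (cross d p q) / (-lin d v)) := by simp only [lin]; ring
    rw [this, (lin_cross d p r).2.1, (lin_cross d p q).2.1]
    have : lin p (cross d q r) = - lin d v := by rw [hv]; simp only [lin, cross]; simp; ring
    rw [this]; field_simp; simp
  · have : lin q (fun i => (u 0 * cross d q r i - u 1 * cross d p r i + u 2 * cross d p q i) / (-lin d v))
      = u 0 * (lin q (cross d q r) / (-lin d v)) - u 1 * (lin q (cross d p r) / (-lin d v)) +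
        u 2 * (lin q (cross d p q) / (-lin d v)) := by simp only [lin]; ring
    rw [this, (lin_cross d q r).2.1, (lin_cross d p q).2.2]
    have : lin q (cross d p r) = lin d v := by rw [hv]; simp only [lin, cross]; simp; ring
    rw [this]; field_simp; simp
  · have : lin r (fun i => (u 0 * cross d q r i - u 1 * cross d p r i + u 2 * cross d p q i) / (-lin d v))
      = u 0 * (lin r (cross d q r) / (-lin d v)) - u 1 * (lin r (cross d p r) / (-lin d v)) +
        u 2 * (lin r (cross d p q) / (-lin d v)) := by simp only [lin]; ring
    rw [this, (lin_cross d q r).2.2, (lin_cross d p r).2.2]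
    have : lin r (cross d p q) = - lin d v := by rw [hv]; simp only [lin, cross]; simp; ring
    rw [this]; field_simp; simp

/-- The polarisation of `quad`. -/
def quadPolar (x v : Fin 4 → ℂ) : ℂ := x 0 * v 3 + x 3 * v 0 - x 1 * v 2 - x 2 * v 1

theorem quad_add_smul (x v : Fin 4 → ℂ) (τ : ℂ) :
    quad (x + τ • v) = quad x + τ * quadPolar x v + τ ^ 2 * quad v := by
  simp [quad, quadPolar]; ring

/-- The quadric is the Segre image: a `2 × 2` matrix of determinant zero has rank at most one. -/
theorem exists_tensor {x : Fin 4 → ℂ} (h : quad x = 0) :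
    ∃ z w : Fin 2 → ℂ, x 0 = z 0 * w 0 ∧ x 1 = z 0 * w 1 ∧ x 2 = z 1 * w 0 ∧ x 3 = z 1 * w 1 := by
  unfold quad at h
  by_cases h0 : x 0 = 0
  · by_cases h1 : x 1 = 0
    · exact ⟨![0, 1], ![x 2, x 3], by simp [h0, h1]⟩
    · have h2 : x 2 = 0 := by
        rw [h0] at h; simpa [h1] using h
      exact ⟨![x 1, x 3], ![0, 1], by simp [h0, h2]⟩
  · refine ⟨![1, x 2 / x 0], ![x 0, x 1], by simp, by simp, ?_, ?_⟩
    · simp; field_simp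
    · simp; field_simp; linear_combination h

/-- Two distinct points of the quadric on a line through a point `v` outside the quadric have
distinct first factors. -/
theorem tensor_det_ne_zero {v x x' : Fin 4 → ℂ} {τ : ℂ} (hv : quad v ≠ 0) (hτ : τ ≠ 0)
    (hx : x' - x = τ • v) {z w z' w' : Fin 2 → ℂ}
    (hx0 : x 0 = z 0 * w 0) (hx1 : x 1 = z 0 * w 1) (hx2 : x 2 = z 1 * w 0) (hx3 : x 3 = z 1 * w 1)
    (hx0' : x' 0 = z' 0 * w' 0) (hx1' : x' 1 = z' 0 * w' 1) (hx2' : x' 2 = z' 1 * w' 0)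
    (hx3' : x' 3 = z' 1 * w' 1) : z 0 * z' 1 - z 1 * z' 0 ≠ 0 := by
  intro h
  have h1 : quad (x' - x) = τ ^ 2 * quad v := by rw [hx]; simp [quad]; ring
  -- On a difference of two decomposable tensors `quad` is, up to sign, the product of the
  -- determinants of the first and of the second factors.
  have h2 : quad (x' - x) = 0 := by
    simp only [quad, Pi.sub_apply, hx0, hx1, hx2, hx3, hx0', hx1', hx2', hx3']
    linear_combination (w 1 * w' 0 - w 0 * w' 1) * h
  rw [h2] at h1
  simp [hτ, hv] at h1

/-- The polynomial over `ℂ` with value `bil p`. -/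
def bilPoly (p : Fin 4 → ℂ) : MvPolynomial (Fin 4) ℂ :=
  bil p (MvPolynomial.X 0) (MvPolynomial.X 1) (MvPolynomial.X 2) (MvPolynomial.X 3)

theorem eval_bilPoly (p e : Fin 4 → ℂ) :
    MvPolynomial.eval e (bilPoly p) = bil p (e 0) (e 1) (e 2) (e 3) := by
  simp [bilPoly, bil]

/-- If `p`, `q`, `r` have no common zero on the quadric, then `1` and `z₁ / z₂` are linearly
independent over the polynomials in `p`, `q`, `r`. -/
theorem eq_zero_of_forall_bil {p q r : Fin 4 → ℂ} (hQ : quad (cross p q r) ≠ 0) {b : ℂ}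
    (hb : b ≠ 0) {P H : MvPolynomial (Fin 3) ℂ}
    (h : ∀ z₁ z₂ w₁ w₂ : ℂ, w₁ * (b * z₁ * MvPolynomial.eval
        ![bil p z₁ z₂ w₁ w₂, bil q z₁ z₂ w₁ w₂, bil r z₁ z₂ w₁ w₂] P +
      z₂ * MvPolynomial.eval
        ![bil p z₁ z₂ w₁ w₂, bil q z₁ z₂ w₁ w₂, bil r z₁ z₂ w₁ w₂] H) = 0) :
    P = 0 ∧ H = 0 := by
  have hvec : ∀ e : Fin 4 → ℂ, (fun i => MvPolynomial.eval e (![bilPoly p, bilPoly q, bilPoly r] i)) =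
      ![bil p (e 0) (e 1) (e 2) (e 3), bil q (e 0) (e 1) (e 2) (e 3),
        bil r (e 0) (e 1) (e 2) (e 3)] := by
    intro e; funext i; fin_cases i <;> simp [eval_bilPoly]
  have hev : ∀ (e : Fin 4 → ℂ) (S : MvPolynomial (Fin 3) ℂ),
      MvPolynomial.eval e (MvPolynomial.bind₁ ![bilPoly p, bilPoly q, bilPoly r] S) =
      MvPolynomial.eval ![bil p (e 0) (e 1) (e 2) (e 3), bil q (e 0) (e 1) (e 2) (e 3),
        bil r (e 0) (e 1) (e 2) (e 3)] S := by
    intro e S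
    rw [← hvec e]
    simp only [MvPolynomial.eval, MvPolynomial.eval₂Hom_bind₁]
  -- cancel the factor `w₁`
  set R : MvPolynomial (Fin 4) ℂ := MvPolynomial.C b * MvPolynomial.X 0 *
    MvPolynomial.bind₁ ![bilPoly p, bilPoly q, bilPoly r] P +
    MvPolynomial.X 1 * MvPolynomial.bind₁ ![bilPoly p, bilPoly q, bilPoly r] H with hR
  have hXR : MvPolynomial.X 2 * R = 0 := by
    refine MvPolynomial.funext fun e => ?_
    simp only [hR, map_mul, map_add, MvPolynomial.eval_X, MvPolynomial.eval_C, hev, map_zero]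
    exact h _ _ _ _
  have hR0 : R = 0 := (mul_eq_zero.mp hXR).resolve_left (MvPolynomial.X_ne_zero 2)
  have hz : ∀ e : Fin 4 → ℂ, b * e 0 * MvPolynomial.eval ![bil p (e 0) (e 1) (e 2) (e 3),
      bil q (e 0) (e 1) (e 2) (e 3), bil r (e 0) (e 1) (e 2) (e 3)] P + e 1 * MvPolynomial.eval
      ![bil p (e 0) (e 1) (e 2) (e 3), bil q (e 0) (e 1) (e 2) (e 3),
      bil r (e 0) (e 1) (e 2) (e 3)] H = 0 := by
    intro e
    have := congrArg (MvPolynomial.eval e) hR0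
    simpa only [hR, map_mul, map_add, MvPolynomial.eval_X, MvPolynomial.eval_C, hev, map_zero]
      using this
  set v := cross p q r with hv
  obtain ⟨hvp, hvq, hvr⟩ := lin_cross p q r
  rw [← hv] at hvp hvq hvr
  have hlin : ∀ (s x : Fin 4 → ℂ) (τ : ℂ), lin s v = 0 → lin s (x + τ • v) = lin s x := by
    intro s x τ hs
    have : lin s (x + τ • v) = lin s x + τ * lin s v := by simp [lin]; ring
    rw [this, hs]; ring
  have hbil : ∀ (s x : Fin 4 → ℂ) (z w : Fin 2 → ℂ), x 0 = z 0 * w 0 → x 1 = z 0 * w 1 →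
      x 2 = z 1 * w 0 → x 3 = z 1 * w 1 → bil s (z 0) (z 1) (w 0) (w 1) = lin s x := by
    intro s x z w h0 h1 h2 h3
    simp [bil, lin, h0, h1, h2, h3]
  -- When this discriminant is nonzero, the line `x + τ v` meets the quadric in two points. The
  -- forms `p, q, r` are constant on the line, so `P` and `H` take the same values at both points,
  -- and the two relations are a linear system with determinant `b * det(z, z')`.
  have hpt : ∀ x : Fin 4 → ℂ, quadPolar x v ^ 2 - 4 * quad x * quad v ≠ 0 →
      MvPolynomial.eval ![lin p x, lin q x, lin r x] P = 0 ∧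
      MvPolynomial.eval ![lin p x, lin q x, lin r x] H = 0 := by
    intro x hx
    obtain ⟨ρ, hρ⟩ := IsAlgClosed.exists_pow_nat_eq
      (quadPolar x v ^ 2 - 4 * quad x * quad v) (n := 2) two_pos
    have hρ0 : ρ ≠ 0 := by rintro rfl; simp at hρ; exact hx hρ.symm
    have hroot : ∀ ε : ℂ, ε ^ 2 = 1 →
        quad (x + ((-quadPolar x v + ε * ρ) / (2 * quad v)) • v) = 0 := by
      intro ε hε
      rw [quad_add_smul]
      field_simp
      linear_combination ε ^ 2 * hρ + (quadPolar x v ^ 2 - 4 * quad x * quad v) * hε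
    obtain ⟨z, w, h0, h1, h2, h3⟩ := exists_tensor (hroot (-1) (by ring))
    obtain ⟨z', w', h0', h1', h2', h3'⟩ := exists_tensor (hroot 1 (by ring))
    have hdet := tensor_det_ne_zero (τ := ρ / quad v) hQ (div_ne_zero hρ0 hQ) (by
      rw [add_sub_add_left_eq_sub, ← sub_smul]
      congr 1
      field_simp
      ring) h0 h1 h2 h3 h0' h1' h2' h3'
    have e1 := hz ![z 0, z 1, w 0, w 1]
    have e2 := hz ![z' 0, z' 1, w' 0, w' 1]
    simp only [Matrix.cons_val] at e1 e2
    rw [hbil p _ z w h0 h1 h2 h3, hbil q _ z w h0 h1 h2 h3, hbil r _ z w h0 h1 h2 h3,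
      hlin p _ _ hvp, hlin q _ _ hvq, hlin r _ _ hvr] at e1
    rw [hbil p _ z' w' h0' h1' h2' h3', hbil q _ z' w' h0' h1' h2' h3',
      hbil r _ z' w' h0' h1' h2' h3', hlin p _ _ hvp, hlin q _ _ hvq, hlin r _ _ hvr] at e2
    constructor
    · refine (mul_eq_zero.mp (?_ : (b * (z 0 * z' 1 - z 1 * z' 0)) * _ = 0)).resolve_left
        (mul_ne_zero hb hdet)
      linear_combination z' 1 * e1 - z 1 * e2
    · refine (mul_eq_zero.mp (?_ : (z 0 * z' 1 - z 1 * z' 0) * _ = 0)).resolve_left hdet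
      linear_combination z 0 * e2 - z' 0 * e1
  let linPoly : (Fin 4 → ℂ) → MvPolynomial (Fin 4) ℂ := fun s =>
    MvPolynomial.C (s 0) * MvPolynomial.X 0 + MvPolynomial.C (s 1) * MvPolynomial.X 1 +
    MvPolynomial.C (s 2) * MvPolynomial.X 2 + MvPolynomial.C (s 3) * MvPolynomial.X 3
  have hevl : ∀ (x : Fin 4 → ℂ) (S : MvPolynomial (Fin 3) ℂ),
      MvPolynomial.eval x (MvPolynomial.bind₁ ![linPoly p, linPoly q, linPoly r] S) =
      MvPolynomial.eval ![lin p x, lin q x, lin r x] S := by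
    intro x S
    have : (fun i => MvPolynomial.eval x (![linPoly p, linPoly q, linPoly r] i)) =
        ![lin p x, lin q x, lin r x] := by
      funext i; fin_cases i <;> simp [linPoly, lin]
    rw [← this]
    simp only [MvPolynomial.eval, MvPolynomial.eval₂Hom_bind₁]
  let D : MvPolynomial (Fin 4) ℂ :=
    (MvPolynomial.X 0 * MvPolynomial.C (v 3) + MvPolynomial.X 3 * MvPolynomial.C (v 0) -
      MvPolynomial.X 1 * MvPolynomial.C (v 2) - MvPolynomial.X 2 * MvPolynomial.C (v 1)) ^ 2 -
    MvPolynomial.C (4 * quad v) *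
      (MvPolynomial.X 0 * MvPolynomial.X 3 - MvPolynomial.X 1 * MvPolynomial.X 2)
  have hD : ∀ x, MvPolynomial.eval x D = quadPolar x v ^ 2 - 4 * quad x * quad v := by
    intro x
    simp [D, quadPolar, quad]; ring
  have hD0 : D ≠ 0 := by
    intro h0
    have hx : ∀ x : Fin 4 → ℂ, quadPolar x v ^ 2 - 4 * quad x * quad v = 0 := by
      intro x; rw [← hD, h0, map_zero]
    have a0 := hx (Pi.single 0 1)
    have a1 := hx (Pi.single 1 1)
    simp [quadPolar, quad] at a0 a1
    apply hQ
    simp [quad, a0, a1]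
  have hfin : ∀ S : MvPolynomial (Fin 3) ℂ,
      (∀ x : Fin 4 → ℂ, quadPolar x v ^ 2 - 4 * quad x * quad v ≠ 0 →
        MvPolynomial.eval ![lin p x, lin q x, lin r x] S = 0) → S = 0 := by
    intro S hS
    -- Multiplication by the discriminant extends the vanishing to all `x`; then `D` cancels, and
    -- surjectivity of `(p, q, r)` onto `ℂ³` gives `S = 0`.
    have : D * MvPolynomial.bind₁ ![linPoly p, linPoly q, linPoly r] S = 0 := by
      refine MvPolynomial.funext fun x => ?_
      rw [map_mul, hevl, hD, map_zero]
      by_cases hx : quadPolar x v ^ 2 - 4 * quad x * quad v = 0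
      · rw [hx, zero_mul]
      · rw [hS x hx, mul_zero]
    have h0 := (mul_eq_zero.mp this).resolve_left hD0
    refine MvPolynomial.funext fun u => ?_
    obtain ⟨x, hp, hq, hr⟩ := exists_lin_eq hQ u
    have := hevl x S
    rw [h0, map_zero, hp, hq, hr] at this
    rw [map_zero, this]
    congr 1
    congr 1
    funext i; fin_cases i <;> rfl
  exact ⟨hfin P fun x hx => (hpt x hx).1, hfin H fun x hx => (hpt x hx).2⟩

/-! ### The pieces of the module as spaces of glued forms -/

/-- The conditions on the coefficients of `g`, `g₁`, `g₂` under which the quotients `gⱼ / g` restrict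
to the two lines with the ratios `exp (cⱼ hⱼ)`. -/
structure Admissible (B : ℂ) (c h : Fin 2 → ℂ) (g : Fin 4 → ℂ) (G : Fin 2 → Fin 4 → ℂ) : Prop where
  B_ne : B ≠ 0
  g_ne : g 3 ≠ 0
  G_ne : ∀ j, G j 3 ≠ 0
  g_zero : g 0 = B * g 1
  g_one : g 1 = B * g 3
  G_zero : ∀ j, G j 0 = B * Complex.exp (c j * h j) * G j 1
  G_one : ∀ j, G j 1 = B * Complex.exp (c j * h j) * G j 3

theorem algebraMap_coeff (σ : Type) (z : ℂ) :
    algebraMap ℂ (MvPolynomial σ Coeff) z = MvPolynomial.C (RatFunc.C z) := rfl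

theorem resZ_bilForm {p : Fin 4 → ℂ} {b : ℂ} (h0 : p 0 = b * p 1) (h1 : p 1 = b * p 3) :
    resZ (bilForm p) = RatFunc.C b • resW (bilForm p) := by
  simp only [bilForm, bil, resZ, resW, Algebra.smul_def, MvPolynomial.algebraMap_eq,
    algebraMap_coeff, map_add, map_mul, MvPolynomial.aeval_X, MvPolynomial.aeval_C,
    Matrix.cons_val]
  rw [h0]
  nth_rewrite 2 [h1]
  simp only [map_mul]
  ring

theorem resW_bilForm_ne_zero {p : Fin 4 → ℂ} (h3 : p 3 ≠ 0) : resW (bilForm p) ≠ 0 := by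
  intro h
  have := congrArg (MvPolynomial.aeval (R := Coeff) ![(0 : Coeff), 1]) h
  simp [bilForm, bil, resW] at this
  exact h3 this

theorem bilForm_ne_zero {p : Fin 4 → ℂ} (h3 : p 3 ≠ 0) : bilForm p ≠ 0 := fun h =>
  resW_bilForm_ne_zero h3 (by rw [h, map_zero])

/-- The function `F(n, P) / g(P)ᵏ · ∏ⱼ (gⱼ(P) / g(P))^{nⱼ}` for a polynomial `F`. -/
def sect (c h : Fin 2 → ℂ) (g : Fin 4 → ℂ) (G : Fin 2 → Fin 4 → ℂ) (k : ℕ) (F : Forms) : DFun :=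
  fun n => algebraMap Forms RatP (twist (expo c h n) F) / algebraMap Forms RatP (bilForm g) ^ k *
    ∏ j, (algebraMap Forms RatP (bilForm (G j)) / algebraMap Forms RatP (bilForm g)) ^ n j

theorem baValue_eq {L : Type} [Field L] [Algebra ℂ L] [Algebra Coeff L] [IsScalarTower ℂ Coeff L]
    (f : Forms →ₐ[Coeff] L) (c h : Fin 2 → ℂ) (g : Fin 4 → ℂ) (G : Fin 2 → Fin 4 → ℂ) (k : ℕ)
    (a : Fin (k + 1) → Fin (k + 1) → Coeff) (n : Fin 2 → ℤ) :
    baValue c h g G k a n (f (MvPolynomial.X 0)) (f (MvPolynomial.X 1)) (f (MvPolynomial.X 2))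
      (f (MvPolynomial.X 3)) =
      f (twist (expo c h n) (biformHom k a)) / f (bilForm g) ^ k *
        ∏ j, (f (bilForm (G j)) / f (bilForm g)) ^ n j := by
  have hb : ∀ p, bil p (f (MvPolynomial.X 0)) (f (MvPolynomial.X 1)) (f (MvPolynomial.X 2))
      (f (MvPolynomial.X 3)) = f (bilForm p) := fun p =>
    (map_bil (f.restrictScalars ℂ) p _ _ _ _).symm
  simp only [baValue, hb, biformHom_twist]
  congr 2
  simp only [biformHom, biform, LinearMap.coe_mk, AddHom.coe_mk, map_sum, map_mul, map_pow,
    AlgHom.commutes, disc_eq]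

section

variable {B : ℂ} {c h : Fin 2 → ℂ} {g : Fin 4 → ℂ} {G : Fin 2 → Fin 4 → ℂ}

/-- Between the two lines `gᵏ` contributes `Bᵏ` and the product of the `(gⱼ / g)^{nⱼ}` contributes
`exp (expo c h n)`. This exponential is the one produced by translating `y⁻¹` by `n`, so the
condition at `n` is the translate of the condition at `0`. -/
theorem gluing_iff (hA : Admissible B c h g G) (Λ : ℂ) (k : ℕ)
    (a : Fin (k + 1) → Fin (k + 1) → Coeff) (n : Fin 2 → ℤ) :
    baValue c h g G k a n (1 : RatT) 0 (tt 0) (tt 1) =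
      algebraMap Coeff RatT (RatFunc.C Λ * RatFunc.X⁻¹) *
        baValue c h g G k a n (tt 0) (tt 1) (0 : RatT) 1 ↔
    resZ (twist (expo c h n) (biformHom k a)) =
      scale (expo c h n) (RatFunc.C (Λ * B ^ k) * RatFunc.X⁻¹) •
        resW (twist (expo c h n) (biformHom k a)) := by
  let ι : LineForms →ₐ[Coeff] RatT := IsScalarTower.toAlgHom Coeff LineForms RatT
  have hι : Function.Injective ι := IsFractionRing.injective LineForms RatT
  have e1 := baValue_eq (ι.comp resZ) c h g G k a n
  have e2 := baValue_eq (ι.comp resW) c h g G k a n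
  have z0 : (ι.comp resZ) (MvPolynomial.X 0) = 1 := by simp [resZ]
  have z1 : (ι.comp resZ) (MvPolynomial.X 1) = 0 := by simp [resZ]
  have z2 : (ι.comp resZ) (MvPolynomial.X 2) = tt 0 := by simp [resZ, ι, tt]
  have z3 : (ι.comp resZ) (MvPolynomial.X 3) = tt 1 := by simp [resZ, ι, tt]
  have w0 : (ι.comp resW) (MvPolynomial.X 0) = tt 0 := by simp [resW, ι, tt]
  have w1 : (ι.comp resW) (MvPolynomial.X 1) = tt 1 := by simp [resW, ι, tt]
  have w2 : (ι.comp resW) (MvPolynomial.X 2) = 0 := by simp [resW]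
  have w3 : (ι.comp resW) (MvPolynomial.X 3) = 1 := by simp [resW]
  rw [z0, z1, z2, z3] at e1
  rw [w0, w1, w2, w3] at e2
  rw [e1, e2]
  simp only [AlgHom.comp_apply]
  set Z := resZ (twist (expo c h n) (biformHom k a))
  set W := resW (twist (expo c h n) (biformHom k a))
  have hsm : ∀ (r : Coeff) (x : LineForms), ι (r • x) = algebraMap Coeff RatT r * ι x := by
    intro r x; rw [map_smul, Algebra.smul_def]
  rw [resZ_bilForm hA.g_zero hA.g_one]
  have hGj : ∀ j, resZ (bilForm (G j)) =
      RatFunc.C (B * Complex.exp (c j * h j)) • resW (bilForm (G j)) := fun j =>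
    resZ_bilForm (hA.G_zero j) (hA.G_one j)
  simp only [hGj, hsm, ← hι.eq_iff (a := Z)]
  have hg0 : ι (resW (bilForm g)) ≠ 0 := by
    rw [map_ne_zero_iff _ hι]; exact resW_bilForm_ne_zero hA.g_ne
  have hG0 : ∀ j, ι (resW (bilForm (G j))) ≠ 0 := fun j => by
    rw [map_ne_zero_iff _ hι]; exact resW_bilForm_ne_zero (hA.G_ne j)
  have hB0 : algebraMap Coeff RatT (RatFunc.C B) ≠ 0 := by simpa using hA.B_ne
  have hprod : ∏ j, (algebraMap Coeff RatT (RatFunc.C (B * Complex.exp (c j * h j))) *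
      ι (resW (bilForm (G j))) / (algebraMap Coeff RatT (RatFunc.C B) * ι (resW (bilForm g)))) ^ n j =
      algebraMap Coeff RatT (RatFunc.C (Complex.exp (expo c h n))) *
        ∏ j, (ι (resW (bilForm (G j))) / ι (resW (bilForm g))) ^ n j := by
    have : Complex.exp (expo c h n) = ∏ j, Complex.exp (c j * h j) ^ n j := by
      rw [expo, Complex.exp_sum]
      refine Finset.prod_congr rfl fun j _ => ?_
      rw [← Complex.exp_int_mul]; congr 1; ring
    rw [this, map_prod, map_prod, ← Finset.prod_mul_distrib]
    refine Finset.prod_congr rfl fun j _ => ?_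
    rw [map_mul, map_mul, map_zpow₀, map_zpow₀, ← mul_zpow]
    congr 1
    field_simp
  rw [hprod]
  have hp0 : ∏ j, (ι (resW (bilForm (G j))) / ι (resW (bilForm g))) ^ n j ≠ 0 :=
    Finset.prod_ne_zero_iff.mpr fun j _ => zpow_ne_zero _ (div_ne_zero (hG0 j) hg0)
  set p := ∏ j, (ι (resW (bilForm (G j))) / ι (resW (bilForm g))) ^ n j
  have he0 : algebraMap Coeff RatT (RatFunc.C (Complex.exp (expo c h n))) ≠ 0 := by
    simp [Complex.exp_ne_zero]
  have hX0 : algebraMap Coeff RatT RatFunc.X ≠ 0 := by simp [RatFunc.X_ne_zero]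
  simp only [map_mul, map_inv₀, map_pow, scale_C, scale_X]
  set e := algebraMap Coeff RatT (RatFunc.C (Complex.exp (expo c h n)))
  set b := algebraMap Coeff RatT (RatFunc.C B)
  rw [div_mul_eq_mul_div, div_mul_eq_mul_div, mul_pow]
  rw [← mul_div_assoc, div_eq_div_iff (by positivity) (by positivity)]
  field_simp

theorem modulePiece_eq (hA : Admissible B c h g G) (Λ : ℂ) (k : ℕ) :
    modulePiece Λ c h g G k =
      sect c h g G k '' (gluedForms (RatFunc.C (Λ * B ^ k) * RatFunc.X⁻¹) k) := by
  have hs : ∀ a n, baValue c h g G k a n (zw 0) (zw 1) (zw 2) (zw 3) =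
      sect c h g G k (biformHom k a) n := fun a n =>
    baValue_eq (IsScalarTower.toAlgHom Coeff Forms RatP) c h g G k a n
  ext φ
  constructor
  · rintro ⟨a, h1, h2⟩
    refine ⟨biformHom k a, ?_, (funext fun n => (h1 n).trans (hs a n)).symm⟩
    -- The condition at `n = 0` suffices; the converse direction recovers every other `n` by
    -- twisting.
    have := (gluing_iff hA Λ k a 0).mp (h2 0)
    rw [expo_zero, twist_zero, scale_zero] at this
    exact mem_gluedForms.mpr ⟨⟨a, rfl⟩, this⟩
  · rintro ⟨F, hF, rfl⟩
    obtain ⟨a, rfl⟩ := (mem_gluedForms.mp hF).1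
    refine ⟨a, fun n => (hs a n).symm, fun n => ?_⟩
    rw [gluing_iff hA]
    exact (mem_gluedForms.mp (gluedForms_twist _ hF)).2

theorem sect_add (k : ℕ) (F F' : Forms) :
    sect c h g G k (F + F') = sect c h g G k F + sect c h g G k F' := by
  funext n
  simp [sect, add_div, add_mul]

theorem sect_zero (k : ℕ) : sect c h g G k 0 = 0 := by
  funext n
  simp [sect]

theorem mulDisc_sect (k : ℕ) (f : Coeff) (F : Forms) :
    mulDisc c h f (sect c h g G k F) = sect c h g G k (f • F) := by
  funext n
  simp only [mulDisc, sect, LinearMap.mulLeft_apply, Pi.mul_apply, Algebra.smul_def,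
    MvPolynomial.algebraMap_eq, map_mul, twist_C, disc_eq,
    IsScalarTower.algebraMap_apply Coeff Forms RatP]
  ring

theorem algebraMap_bilForm_ne_zero {p : Fin 4 → ℂ} (h3 : p 3 ≠ 0) :
    algebraMap Forms RatP (bilForm p) ≠ 0 := by
  rw [map_ne_zero_iff _ (IsFractionRing.injective Forms RatP)]
  exact bilForm_ne_zero h3

theorem sect_mul_bilForm_pow (hA : Admissible B c h g G) (k e : ℕ) (F : Forms) :
    sect c h g G (k + e) (F * bilForm g ^ e) = sect c h g G k F := by
  have := algebraMap_bilForm_ne_zero hA.g_ne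
  funext n
  simp only [sect, map_mul, map_pow, twist_bilForm]
  congr 1
  rw [pow_add]
  field_simp

theorem sect_injective (hA : Admissible B c h g G) (k : ℕ) :
    Function.Injective (sect c h g G k) := by
  intro F F' hF
  -- At `n = 0` both the twist and the product are trivial.
  have := congrFun hF 0
  have h0 := algebraMap_bilForm_ne_zero hA.g_ne
  simp only [sect, expo_zero, twist_zero, Pi.zero_apply, zpow_zero, Finset.prod_const_one,
    mul_one] at this
  exact IsFractionRing.injective Forms RatP ((div_left_inj' (pow_ne_zero k h0)).mp this)

/-- The translation `n ↦ n + m` on functions of `n`. -/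
def translate (m : Fin 2 →₀ ℕ) : Module.End ℂ DFun :=
  LinearMap.funLeft ℂ RatP fun n : Fin 2 → ℤ => n + fun i => (m i : ℤ)

theorem translate_zero : translate 0 = 1 := by
  ext φ n
  simp only [translate, LinearMap.funLeft_apply, Finsupp.coe_zero, Pi.zero_apply, Nat.cast_zero,
    Module.End.one_apply]
  congr 1
  exact add_zero n

theorem translate_add (m m' : Fin 2 →₀ ℕ) : translate (m + m') = translate m * translate m' := by
  ext φ n
  simp only [translate, Module.End.mul_apply, LinearMap.funLeft_apply]
  congr 1
  funext i
  simp [add_assoc]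

theorem shift_eq_translate (i : Fin 2) : shift i = translate (Finsupp.single i 1) := by
  ext φ n
  simp only [translate, shift, LinearMap.funLeft_apply]
  congr 1
  funext j
  simp [Pi.single_apply, Finsupp.single_apply, eq_comm]

/-- The shift produces extra factors `gⱼ / g`: their numerators join the form and their denominators
raise the pole order by `|m|`. -/
theorem translate_sect (hA : Admissible B c h g G) (k : ℕ) (F : Forms) (m : Fin 2 →₀ ℕ) :
    translate m (sect c h g G k F) = sect c h g G (k + (m 0 + m 1))
      (twist (expo c h fun i => m i) F * (bilForm (G 0) ^ m 0 * bilForm (G 1) ^ m 1)) := by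
  have hg0 := algebraMap_bilForm_ne_zero hA.g_ne
  have hG0 := fun j => algebraMap_bilForm_ne_zero (hA.G_ne j)
  funext n
  simp only [translate, LinearMap.funLeft_apply, sect, map_mul, map_pow, twist_bilForm,
    twist_twist, ← expo_add, Fin.prod_univ_two, Pi.add_apply]
  rw [zpow_add₀ (div_ne_zero (hG0 0) hg0), zpow_add₀ (div_ne_zero (hG0 1) hg0), zpow_natCast,
    zpow_natCast]
  simp only [div_pow, pow_add]
  field_simp

theorem translate_mulDisc (m : Fin 2 →₀ ℕ) (f : Coeff) :
    translate m * mulDisc c h f = mulDisc c h (scale (expo c h fun i => m i) f) * translate m := by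
  ext φ n
  simp only [translate, mulDisc, Module.End.mul_apply, LinearMap.funLeft_apply,
    LinearMap.mulLeft_apply, Pi.mul_apply, disc_eq, scale_scale, expo_add]

end

/-! ### The generators and the independence of their translates -/

/-- Vectors of polynomials are linearly independent if their values at `0` are. -/
theorem linearIndependent_of_eval_zero {ι E : Type} {v : ι → E → Polynomial ℂ}
    (hv : LinearIndependent ℂ fun i e => (v i e).eval 0) :
    LinearIndependent (Polynomial ℂ) v := by
  rw [linearIndependent_iff'] at hv ⊢
  intro S f hf
  -- Descent: independence at `0` makes every coefficient of a relation divisible by the variable,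
  -- and the quotients satisfy the same relation.
  have hdvd : ∀ N : ℕ, ∀ f : ι → Polynomial ℂ, ∑ i ∈ S, f i • v i = 0 →
      ∀ i ∈ S, Polynomial.X ^ N ∣ f i := by
    intro N
    induction N with
    | zero => simp
    | succ N ih =>
      intro f hf
      have h0 : ∀ i ∈ S, Polynomial.X ∣ f i := by
        intro i hi
        rw [Polynomial.X_dvd_iff, Polynomial.coeff_zero_eq_eval_zero]
        refine hv S (fun i => (f i).eval 0) ?_ i hi
        funext e
        have := congrArg (Polynomial.eval 0) (congrFun hf e)
        simpa [Polynomial.eval_finsetSum] using this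
      choose! q hq using h0
      intro i hi
      rw [hq i hi, pow_succ']
      refine mul_dvd_mul_left _ (ih q ?_ i hi)
      funext e
      have := congrFun hf e
      rw [Finset.sum_congr rfl fun i hi => by rw [hq i hi]] at this
      simp only [Finset.sum_apply, Pi.smul_apply, smul_eq_mul, mul_assoc, ← Finset.mul_sum,
        Pi.zero_apply] at this ⊢
      exact (mul_eq_zero.mp this).resolve_left Polynomial.X_ne_zero
  intro i hi
  by_contra h0
  have h1 := hdvd ((f i).natDegree + 1) f hf i hi
  have := Polynomial.natDegree_le_of_dvd h1 h0
  simp at this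

/-- Distinct monomials in two variables are linearly independent as functions. -/
theorem coeff_eq_zero_of_forall_eval {T : Finset (Fin 2 →₀ ℕ)} {f : (Fin 2 →₀ ℕ) → ℂ}
    (h : ∀ x y : ℂ, ∑ m ∈ T, f m * (x ^ m 0 * y ^ m 1) = 0) : ∀ m ∈ T, f m = 0 := by
  intro m hm
  have h0 : ∑ m ∈ T, MvPolynomial.monomial m (f m) = 0 := by
    refine MvPolynomial.funext fun x => ?_
    simpa [map_sum, MvPolynomial.eval_monomial, Finsupp.prod_fintype] using h (x 0) (x 1)
  have h1 := congrArg (MvPolynomial.coeff m) h0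
  simpa [MvPolynomial.coeff_sum, MvPolynomial.coeff_monomial, hm] using h1

/-- The two generators, both in the piece `k = 1`:
`(Λ B)² z₁ w₁ + Λ B y z₁ w₂ + y² z₂ w₂` and `z₂ w₁`. -/
def gen (L : ℂ) (a : Fin 2) : Forms :=
  -- With `μ = L y⁻¹`, gluing in bidegree `(1, 1)` reads `a₁₀ = μ a₀₀`, `a₁₁ = μ a₁₀`, with `a₀₁`
  -- free. Taking `a₀₀ = y²` clears denominators and leaves only `z₁ w₁` at `y = 0`.
  biformHom 1 (![![![RatFunc.X ^ 2, 0], ![RatFunc.C L * RatFunc.X, RatFunc.C (L ^ 2)]],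
    ![![0, 1], ![0, 0]]] a)

theorem gen_zero (L : ℂ) : gen L 0 =
    MvPolynomial.C (RatFunc.C (L ^ 2)) * (MvPolynomial.X 0 * MvPolynomial.X 2) +
    MvPolynomial.C (RatFunc.C L * RatFunc.X) * (MvPolynomial.X 0 * MvPolynomial.X 3) +
    MvPolynomial.C (RatFunc.X ^ 2) * (MvPolynomial.X 1 * MvPolynomial.X 3) := by
  simp [gen, biformHom, biform, Fin.sum_univ_two, MvPolynomial.algebraMap_eq]
  ring

theorem gen_one (L : ℂ) : gen L 1 = MvPolynomial.X 1 * MvPolynomial.X 2 := by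
  simp [gen, biformHom, biform, Fin.sum_univ_two]

theorem gen_mem (L : ℂ) (a : Fin 2) :
    gen L a ∈ gluedForms (RatFunc.C L * RatFunc.X⁻¹) 1 := by
  refine mem_gluedForms.mpr ⟨⟨_, rfl⟩, ?_⟩
  have hX : (RatFunc.X : Coeff) ≠ 0 := RatFunc.X_ne_zero
  rw [gen, resZ_biformHom, resW_biformHom, Finset.smul_sum]
  refine Finset.sum_congr rfl fun j _ => ?_
  rw [Algebra.smul_def, MvPolynomial.algebraMap_eq, ← mul_assoc (MvPolynomial.C (_ * _)), ← map_mul]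
  congr 2
  fin_cases a <;> fin_cases j <;> simp [Fin.last] <;> field_simp

/-- The polynomial of `T^m` applied to the generator `a`, in bidegree `(k + 1, k + 1)`. -/
def family (L : ℂ) (c h : Fin 2 → ℂ) (g : Fin 4 → ℂ) (G : Fin 2 → Fin 4 → ℂ) (k : ℕ)
    (x : Fin 2 × (Fin 2 →₀ ℕ)) : Forms :=
  twist (expo c h fun i => x.2 i) (gen L x.1) *
    (bilForm (G 0) ^ x.2 0 * bilForm (G 1) ^ x.2 1) * bilForm g ^ (k - (x.2 0 + x.2 1))

section

variable {B : ℂ} {c h : Fin 2 → ℂ} {g : Fin 4 → ℂ} {G : Fin 2 → Fin 4 → ℂ}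

theorem gluedForms_mul_base_pow (hA : Admissible B c h g G) {Λ : ℂ} {k : ℕ} {F : Forms}
    (hF : F ∈ gluedForms (RatFunc.C (Λ * B ^ k) * RatFunc.X⁻¹) k) (e : ℕ) :
    F * bilForm g ^ e ∈ gluedForms (RatFunc.C (Λ * B ^ (k + e)) * RatFunc.X⁻¹) (k + e) := by
  have h1 := gluedForms_mul_bilForm_pow hF (resZ_bilForm hA.g_zero hA.g_one) e
  convert h1 using 2
  rw [pow_add, ← mul_assoc, map_mul _ (Λ * B ^ k), map_pow]
  ring

/-- Twisting divides the multiplier by `exp (expo c h m)`, and the factors `gⱼ` restore this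
exponential together with `B^{|m|}`. -/
theorem gluedForms_translate (hA : Admissible B c h g G) {Λ : ℂ} {k : ℕ} {F : Forms}
    (hF : F ∈ gluedForms (RatFunc.C (Λ * B ^ k) * RatFunc.X⁻¹) k) (m : Fin 2 →₀ ℕ) :
    twist (expo c h fun i => m i) F * (bilForm (G 0) ^ m 0 * bilForm (G 1) ^ m 1) ∈
      gluedForms (RatFunc.C (Λ * B ^ (k + (m 0 + m 1))) * RatFunc.X⁻¹) (k + (m 0 + m 1)) := by
  have h1 := gluedForms_mul_bilForm_pow (gluedForms_mul_bilForm_pow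
    (gluedForms_twist (expo c h fun i => m i) hF)
    (resZ_bilForm (hA.G_zero 0) (hA.G_one 0)) (m 0))
    (resZ_bilForm (hA.G_zero 1) (hA.G_one 1)) (m 1)
  rw [mul_assoc (twist _ _), add_assoc] at h1
  convert h1 using 2
  have hX : (RatFunc.X : Coeff) ≠ 0 := RatFunc.X_ne_zero
  have he : Complex.exp (expo c h fun i => m i) =
      Complex.exp (c 0 * h 0) ^ m 0 * Complex.exp (c 1 * h 1) ^ m 1 := by
    rw [expo, Complex.exp_sum, Fin.prod_univ_two, ← Complex.exp_nat_mul, ← Complex.exp_nat_mul]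
    congr 2 <;> push_cast <;> ring
  simp only [map_mul, map_inv₀, scale_C, scale_X, he, map_pow]
  have e0 : RatFunc.C (Complex.exp (c 0 * h 0)) ≠ 0 := by simp [Complex.exp_ne_zero]
  have e1 : RatFunc.C (Complex.exp (c 1 * h 1)) ≠ 0 := by simp [Complex.exp_ne_zero]
  field_simp
  ring

theorem gen_mem_gluedForms (Λ : ℂ) (a : Fin 2) :
    gen (Λ * B) a ∈ gluedForms (RatFunc.C (Λ * B ^ 1) * RatFunc.X⁻¹) 1 := by
  rw [pow_one]; exact gen_mem _ a

theorem family_mem (hA : Admissible B c h g G) (Λ : ℂ) {k : ℕ} {x : Fin 2 × (Fin 2 →₀ ℕ)}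
    (hx : x.2 0 + x.2 1 ≤ k) : family (Λ * B) c h g G k x ∈
      gluedForms (RatFunc.C (Λ * B ^ (k + 1)) * RatFunc.X⁻¹) (k + 1) := by
  have h1 := gluedForms_mul_base_pow hA (gluedForms_translate hA (gen_mem_gluedForms Λ x.1) x.2)
    (k - (x.2 0 + x.2 1))
  rwa [show 1 + (x.2 0 + x.2 1) + (k - (x.2 0 + x.2 1)) = k + 1 by omega] at h1

/-- The value at `y = 0` of the polynomials in `y` which `family` takes at the point `e`. -/
theorem family_eval (L : ℂ) (k : ℕ) (x : Fin 2 × (Fin 2 →₀ ℕ)) (e : Fin 4 → ℂ) :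
    ∃ p : Polynomial ℂ, aeval (fun i => RatFunc.C (e i)) (family L c h g G k x) =
        algebraMap (Polynomial ℂ) Coeff p ∧
      p.eval 0 = ![L ^ 2 * (e 0 * e 2), e 1 * e 2] x.1 *
        (bil (G 0) (e 0) (e 1) (e 2) (e 3) ^ x.2 0 * bil (G 1) (e 0) (e 1) (e 2) (e 3) ^ x.2 1 *
          bil g (e 0) (e 1) (e 2) (e 3) ^ (k - (x.2 0 + x.2 1))) := by
  obtain ⟨a, m⟩ := x
  have hb : ∀ q, aeval (R := Coeff) (fun i => RatFunc.C (e i)) (bilForm q) =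
      algebraMap (Polynomial ℂ) Coeff (Polynomial.C (bil q (e 0) (e 1) (e 2) (e 3))) := by
    intro q
    rw [RatFunc.algebraMap_C]
    simp [bilForm, bil]
  set E := Complex.exp (expo c h fun i => m i)
  -- The twist enters only through `E`, which accompanies positive powers of `y` and so disappears
  -- at `y = 0`.
  refine ⟨![Polynomial.C (L ^ 2 * (e 0 * e 2)) + Polynomial.C (L * E * (e 0 * e 3)) * Polynomial.X +
      Polynomial.C (E ^ 2 * (e 1 * e 3)) * Polynomial.X ^ 2, Polynomial.C (e 1 * e 2)] a *
    (Polynomial.C (bil (G 0) (e 0) (e 1) (e 2) (e 3)) ^ m 0 *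
     Polynomial.C (bil (G 1) (e 0) (e 1) (e 2) (e 3)) ^ m 1 *
     Polynomial.C (bil g (e 0) (e 1) (e 2) (e 3)) ^ (k - (m 0 + m 1))), ?_, ?_⟩
  · simp only [family, map_mul, map_pow, hb]
    rw [mul_assoc]
    congr 1
    fin_cases a
    · simp only [Fin.zero_eta, gen_zero, map_add, map_mul, twist_C, twist_X, scale_C, scale_X, map_pow,
        MvPolynomial.aeval_C, MvPolynomial.aeval_X, Matrix.cons_val, RatFunc.algebraMap_C,
        RatFunc.algebraMap_X, Algebra.algebraMap_self, RingHom.id_apply]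
      ring
    · simp [gen_one, RatFunc.algebraMap_C]
  · fin_cases a <;> simp

/-- Evaluation at complex points and then at `y = 0` reduces a relation to `w₁ (L² z₁ P + z₂ H) = 0`
with `P, H` polynomials in `g, g₁, g₂`. Independence then climbs back from `ℂ` to `ℂ[y]` and, by
clearing denominators, to `ℂ(y)`. -/
theorem family_linearIndepOn {L : ℂ} (hL : L ≠ 0) (hQ : quad (cross g (G 0) (G 1)) ≠ 0) {k : ℕ}
    (T : Finset (Fin 2 →₀ ℕ)) :
    LinearIndepOn Coeff (family L c h g G k) ((Finset.univ ×ˢ T : Finset (Fin 2 × (Fin 2 →₀ ℕ))) : Set _) := by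
  let ev : Forms →ₗ[Coeff] ((Fin 4 → ℂ) → Coeff) :=
    LinearMap.pi fun e => (aeval (R := Coeff) fun i => RatFunc.C (e i)).toLinearMap
  choose p hp hp0 using family_eval (c := c) (h := h) (g := g) (G := G) L k
  have hev : ev ∘ family L c h g G k =
      (Algebra.linearMap (Polynomial ℂ) Coeff).compLeft (Fin 4 → ℂ) ∘ p := by
    funext x e
    exact hp x e
  have h0 : LinearIndepOn ℂ (fun x e => (p x e).eval 0) ((Finset.univ ×ˢ T : Finset (Fin 2 × (Fin 2 →₀ ℕ))) : Set _) := by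
    rw [linearIndepOn_finset_iff]
    intro f hf
    have hsum : ∀ a : Fin 2, ∀ u : Fin 3 → ℂ, MvPolynomial.eval u (∑ m ∈ T,
        MvPolynomial.C (f (a, m)) * (MvPolynomial.X 1 ^ m 0 * MvPolynomial.X 2 ^ m 1 *
          MvPolynomial.X 0 ^ (k - (m 0 + m 1)))) =
        ∑ m ∈ T, f (a, m) * (u 1 ^ m 0 * u 2 ^ m 1 * u 0 ^ (k - (m 0 + m 1))) := by
      intro a u; simp [map_sum]
    have hPH := eq_zero_of_forall_bil hQ (b := L ^ 2) (pow_ne_zero 2 hL)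
      (P := ∑ m ∈ T, MvPolynomial.C (f (0, m)) * (MvPolynomial.X 1 ^ m 0 * MvPolynomial.X 2 ^ m 1 *
          MvPolynomial.X 0 ^ (k - (m 0 + m 1))))
      (H := ∑ m ∈ T, MvPolynomial.C (f (1, m)) * (MvPolynomial.X 1 ^ m 0 * MvPolynomial.X 2 ^ m 1 *
          MvPolynomial.X 0 ^ (k - (m 0 + m 1)))) (by
        intro z₁ z₂ w₁ w₂
        have h1 := congrFun hf ![z₁, z₂, w₁, w₂]
        simp only [Finset.sum_product, Fin.sum_univ_two, Finset.sum_apply,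
          Pi.smul_apply, smul_eq_mul, hp0, Pi.zero_apply, Matrix.cons_val] at h1
        simp only [hsum, Matrix.cons_val]
        rw [← h1, mul_add]
        congr 1
        · rw [← mul_assoc, Finset.mul_sum]
          exact Finset.sum_congr rfl fun m _ => by ring
        · rw [← mul_assoc, Finset.mul_sum]
          exact Finset.sum_congr rfl fun m _ => by ring)
    have hfin : ∀ a : Fin 2, ∑ m ∈ T, MvPolynomial.C (f (a, m)) * (MvPolynomial.X 1 ^ m 0 *
        MvPolynomial.X 2 ^ m 1 * MvPolynomial.X (0 : Fin 3) ^ (k - (m 0 + m 1))) = 0 := by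
      intro a; fin_cases a
      exacts [hPH.1, hPH.2]
    rintro ⟨a, m⟩ hx
    refine coeff_eq_zero_of_forall_eval (T := T) (f := fun m => f (a, m)) ?_ m
      (Finset.mem_product.mp hx).2
    intro x y
    -- Putting `1` in the slot of `g` removes the padding exponent, so even indices of degree above
    -- `k` cause no harm.
    have := hsum a ![1, x, y]
    rw [hfin a] at this
    simpa using this.symm
  have h1 : LinearIndepOn (Polynomial ℂ) p ((Finset.univ ×ˢ T : Finset (Fin 2 × (Fin 2 →₀ ℕ))) : Set _) :=
    linearIndependent_of_eval_zero h0
  have h2 : LinearIndepOn (Polynomial ℂ)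
      ((Algebra.linearMap (Polynomial ℂ) Coeff).compLeft (Fin 4 → ℂ) ∘ p)
      ((Finset.univ ×ˢ T : Finset (Fin 2 × (Fin 2 →₀ ℕ))) : Set _) := by
    refine LinearIndependent.map' h1 _ ?_
    rw [LinearMap.ker_eq_bot]
    exact (RatFunc.algebraMap_injective ℂ).comp_left
  rw [← hev] at h2
  have h3 := (LinearIndependent.iff_fractionRing (Polynomial ℂ) Coeff).mp h2
  exact LinearIndependent.of_comp ev h3

end

/-! ### Normal form of difference operators -/

theorem mulDisc_add (c h : Fin 2 → ℂ) (f f' : Coeff) :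
    mulDisc c h (f + f') = mulDisc c h f + mulDisc c h f' := by
  ext φ n
  simp [mulDisc, disc_eq, add_mul]

theorem mulDisc_mul (c h : Fin 2 → ℂ) (f f' : Coeff) :
    mulDisc c h (f * f') = mulDisc c h f * mulDisc c h f' := by
  ext φ n
  simp [mulDisc, disc_eq, mul_assoc]

theorem mulDisc_C (c h : Fin 2 → ℂ) (r : ℂ) :
    mulDisc c h (RatFunc.C r) = algebraMap ℂ (Module.End ℂ DFun) r := by
  ext φ n
  simp only [mulDisc, disc_eq, scale_C, LinearMap.mulLeft_apply, Pi.mul_apply,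
    Module.algebraMap_end_apply, Pi.smul_apply, Algebra.smul_def]
  rfl

/-- The difference operator `∑ f̂ₘ T^m`. -/
def opOf (c h : Fin 2 → ℂ) : ((Fin 2 →₀ ℕ) →₀ Coeff) →+ Module.End ℂ DFun :=
  Finsupp.liftAddHom fun m => AddMonoidHom.mk' (fun f => mulDisc c h f * translate m) fun f f' => by
    rw [mulDisc_add, add_mul]

theorem opOf_single (c h : Fin 2 → ℂ) (m : Fin 2 →₀ ℕ) (f : Coeff) :
    opOf c h (Finsupp.single m f) = mulDisc c h f * translate m :=
  Finsupp.liftAddHom_apply_single _ m f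

theorem opOf_eq_sum (c h : Fin 2 → ℂ) {F : (Fin 2 →₀ ℕ) →₀ Coeff} {T : Finset (Fin 2 →₀ ℕ)}
    (hT : F.support ⊆ T) : opOf c h F = ∑ m ∈ T, mulDisc c h (F m) * translate m := by
  have hF : F = ∑ m ∈ T, Finsupp.single m (F m) := by
    rw [← Finsupp.sum_of_support_subset F hT (fun m f => Finsupp.single m f) (by simp),
      Finsupp.sum_single]
  conv_lhs => rw [hF]
  simp only [map_sum, opOf_single]

theorem mulDisc_mul_opOf (c h : Fin 2 → ℂ) (f : Coeff) (F : (Fin 2 →₀ ℕ) →₀ Coeff) :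
    ∃ F', opOf c h F' = mulDisc c h f * opOf c h F := by
  induction F using Finsupp.induction_linear with
  | zero => exact ⟨0, by simp⟩
  | add F₁ F₂ h₁ h₂ =>
    obtain ⟨F₁', h₁⟩ := h₁
    obtain ⟨F₂', h₂⟩ := h₂
    exact ⟨F₁' + F₂', by rw [map_add, h₁, h₂, map_add, mul_add]⟩
  | single m f' =>
    exact ⟨Finsupp.single m (f * f'), by rw [opOf_single, opOf_single, mulDisc_mul, mul_assoc]⟩

theorem shift_mul_opOf (c h : Fin 2 → ℂ) (i : Fin 2) (F : (Fin 2 →₀ ℕ) →₀ Coeff) :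
    ∃ F', opOf c h F' = shift i * opOf c h F := by
  induction F using Finsupp.induction_linear with
  | zero => exact ⟨0, by simp⟩
  | add F₁ F₂ h₁ h₂ =>
    obtain ⟨F₁', h₁⟩ := h₁
    obtain ⟨F₂', h₂⟩ := h₂
    exact ⟨F₁' + F₂', by rw [map_add, h₁, h₂, map_add, mul_add]⟩
  | single m f' =>
    refine ⟨Finsupp.single (Finsupp.single i 1 + m) (scale (expo c h fun j => (Finsupp.single i 1 : Fin 2 →₀ ℕ) j) f'), ?_⟩
    rw [opOf_single, opOf_single, shift_eq_translate, ← mul_assoc, translate_mulDisc, mul_assoc,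
      ← translate_add]

theorem opOf_one (c h : Fin 2 → ℂ) : opOf c h (Finsupp.single 0 1) = 1 := by
  rw [opOf_single, translate_zero, mul_one, ← map_one RatFunc.C, mulDisc_C, map_one]

/-- Every difference operator has the form `∑ f̂ₘ T^m`. -/
theorem exists_opOf_eq {c h : Fin 2 → ℂ} {D : Module.End ℂ DFun} (hD : D ∈ diffOps c h) :
    ∃ F, opOf c h F = D := by
  -- Stability of normal forms under left multiplication passes to products of operators, whereas
  -- mere existence of a normal form would not.
  suffices hs : ∀ F, ∃ F', opOf c h F' = D * opOf c h F by
    obtain ⟨F, hF⟩ := hs (Finsupp.single 0 1)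
    exact ⟨F, by rw [hF, opOf_one, mul_one]⟩
  induction hD using Algebra.adjoin_induction with
  | mem D hD =>
    rcases hD with ⟨f, rfl⟩ | ⟨i, rfl⟩
    · exact mulDisc_mul_opOf c h f
    · exact shift_mul_opOf c h i
  | algebraMap r => rw [← mulDisc_C c h]; exact mulDisc_mul_opOf c h _
  | add D₁ D₂ _ _ h₁ h₂ =>
    intro F
    obtain ⟨F₁, h₁⟩ := h₁ F
    obtain ⟨F₂, h₂⟩ := h₂ F
    exact ⟨F₁ + F₂, by rw [map_add, h₁, h₂, add_mul]⟩
  | mul D₁ D₂ _ _ h₁ h₂ =>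
    intro F
    obtain ⟨F₂, h₂⟩ := h₂ F
    obtain ⟨F₁, h₁⟩ := h₁ F₂
    exact ⟨F₁, by rw [h₁, h₂, mul_assoc]⟩

theorem mulDisc_mem (c h : Fin 2 → ℂ) (f : Coeff) : mulDisc c h f ∈ diffOps c h :=
  Algebra.subset_adjoin (Or.inl ⟨f, rfl⟩)

theorem translate_mem (c h : Fin 2 → ℂ) (m : Fin 2 →₀ ℕ) : translate m ∈ diffOps c h := by
  induction m using Finsupp.induction_linear with
  | zero => rw [translate_zero]; exact one_mem _
  | add m m' h₁ h₂ => rw [translate_add]; exact mul_mem h₁ h₂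
  | single i e =>
    induction e with
    | zero => rw [Finsupp.single_zero, translate_zero]; exact one_mem _
    | succ e ih =>
      rw [Finsupp.single_add, translate_add, ← shift_eq_translate]
      exact mul_mem ih (Algebra.subset_adjoin (Or.inr ⟨i, rfl⟩))

theorem opOf_mem (c h : Fin 2 → ℂ) (F : (Fin 2 →₀ ℕ) →₀ Coeff) : opOf c h F ∈ diffOps c h := by
  rw [opOf_eq_sum c h subset_rfl]
  exact sum_mem fun m _ => mul_mem (mulDisc_mem c h _) (translate_mem c h m)

/-! ### The module and its basis -/

section

variable {B : ℂ} {c h : Fin 2 → ℂ} {g : Fin 4 → ℂ} {G : Fin 2 → Fin 4 → ℂ}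

theorem modulePiece_mono (hA : Admissible B c h g G) (Λ : ℂ) :
    Monotone (modulePiece Λ c h g G) := by
  intro k l hkl φ hφ
  obtain ⟨e, rfl⟩ := Nat.exists_eq_add_of_le hkl
  rw [modulePiece_eq hA] at hφ ⊢
  obtain ⟨F, hF, rfl⟩ := hφ
  exact ⟨_, gluedForms_mul_base_pow hA hF e, sect_mul_bilForm_pow hA k e F⟩

theorem modulePiece_add (hA : Admissible B c h g G) (Λ : ℂ) {k : ℕ} {φ ψ : DFun}
    (hφ : φ ∈ modulePiece Λ c h g G k) (hψ : ψ ∈ modulePiece Λ c h g G k) :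
    φ + ψ ∈ modulePiece Λ c h g G k := by
  rw [modulePiece_eq hA] at hφ hψ ⊢
  obtain ⟨F, hF, rfl⟩ := hφ
  obtain ⟨F', hF', rfl⟩ := hψ
  exact ⟨_, add_mem hF hF', sect_add k F F'⟩

theorem modulePiece_zero_mem (hA : Admissible B c h g G) (Λ : ℂ) (k : ℕ) :
    0 ∈ modulePiece Λ c h g G k := by
  rw [modulePiece_eq hA]
  exact ⟨0, zero_mem _, sect_zero k⟩

theorem modulePiece_mulDisc_translate (hA : Admissible B c h g G) (Λ : ℂ) {k : ℕ} {φ : DFun}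
    (hφ : φ ∈ modulePiece Λ c h g G k) (f : Coeff) (m : Fin 2 →₀ ℕ) :
    (mulDisc c h f * translate m) φ ∈ modulePiece Λ c h g G (k + (m 0 + m 1)) := by
  rw [modulePiece_eq hA] at hφ ⊢
  obtain ⟨F, hF, rfl⟩ := hφ
  rw [Module.End.mul_apply, translate_sect hA, mulDisc_sect]
  exact ⟨_, Submodule.smul_mem _ f (gluedForms_translate hA hF m), rfl⟩

/-- The discrete Baker-Akhiezer module. -/
def bakerModule (hA : Admissible B c h g G) (Λ : ℂ) : Submodule (diffOps c h) DFun where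
  carrier := ⋃ k : ℕ, modulePiece Λ c h g G k
  add_mem' {φ ψ} hφ hψ := by
    obtain ⟨k, hk⟩ := Set.mem_iUnion.mp hφ
    obtain ⟨l, hl⟩ := Set.mem_iUnion.mp hψ
    exact Set.mem_iUnion.mpr ⟨max k l, modulePiece_add hA Λ
      (modulePiece_mono hA Λ (le_max_left k l) hk) (modulePiece_mono hA Λ (le_max_right k l) hl)⟩
  zero_mem' := Set.mem_iUnion.mpr ⟨0, modulePiece_zero_mem hA Λ 0⟩
  smul_mem' := by
    rintro ⟨D, hD⟩ φ hφ
    obtain ⟨k, hk⟩ := Set.mem_iUnion.mp hφ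
    obtain ⟨F, rfl⟩ := exists_opOf_eq hD
    change opOf c h F φ ∈ ⋃ k : ℕ, modulePiece Λ c h g G k
    rw [opOf_eq_sum c h subset_rfl, LinearMap.sum_apply]
    refine Set.mem_iUnion.mpr ⟨k + F.support.sup fun m => m 0 + m 1, ?_⟩
    refine Finset.sum_induction _ (· ∈ modulePiece Λ c h g G _)
      (fun _ _ => modulePiece_add hA Λ) (modulePiece_zero_mem hA Λ _) fun m hm => ?_
    exact modulePiece_mono hA Λ
      (Nat.add_le_add_left (Finset.le_sup (f := fun m : Fin 2 →₀ ℕ => m 0 + m 1) hm) k)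
      (modulePiece_mulDisc_translate hA Λ hk _ m)

theorem sect_sum {ι : Type} (k : ℕ) (T : Finset ι) (F : ι → Forms) :
    sect c h g G k (∑ i ∈ T, F i) = ∑ i ∈ T, sect c h g G k (F i) :=
  map_sum (AddMonoidHom.mk' (sect c h g G k) (sect_add k)) F T

/-- Padding by powers of `g` brings all translates to the common denominator `g^{k + 1}`, turning
operator identities into linear algebra over `𝒦`. -/
theorem opOf_sect_gen (hA : Admissible B c h g G) (L : ℂ) (a : Fin 2) {k : ℕ}
    {F : (Fin 2 →₀ ℕ) →₀ Coeff} {T : Finset (Fin 2 →₀ ℕ)} (hT : F.support ⊆ T)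
    (hk : ∀ m ∈ T, m 0 + m 1 ≤ k) :
    opOf c h F (sect c h g G 1 (gen L a)) =
      sect c h g G (k + 1) (∑ m ∈ T, F m • family L c h g G k (a, m)) := by
  rw [opOf_eq_sum c h hT, LinearMap.sum_apply, sect_sum]
  refine Finset.sum_congr rfl fun m hm => ?_
  rw [Module.End.mul_apply, translate_sect hA, ← mulDisc_sect,
    ← sect_mul_bilForm_pow hA _ (k - (m 0 + m 1)),
    show 1 + (m 0 + m 1) + (k - (m 0 + m 1)) = k + 1 by have := hk m hm; omega]
  rfl

/-- The multi-indices of degree at most `k`. -/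
def lowDegree (k : ℕ) : Finset (Fin 2 →₀ ℕ) :=
  ((Finset.range (k + 1)).sigma fun i => Finset.range (i + 1)).image
    fun x => Finsupp.single 0 x.2 + Finsupp.single 1 (x.1 - x.2)

theorem lowDegree_le {k : ℕ} {m : Fin 2 →₀ ℕ} (hm : m ∈ lowDegree k) : m 0 + m 1 ≤ k := by
  simp only [lowDegree, Finset.mem_image, Finset.mem_sigma, Finset.mem_range] at hm
  obtain ⟨x, hx, rfl⟩ := hm
  simp
  omega

/-- With two generators this number of translates matches the bound of `finrank_gluedForms_le`
exactly. -/
theorem card_lowDegree (k : ℕ) : 2 * (lowDegree k).card = (k + 1) * (k + 2) := by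
  rw [lowDegree, Finset.card_image_of_injOn, Finset.card_sigma]
  · simp only [Finset.card_range]
    induction k with
    | zero => simp
    | succ k ih => rw [Finset.sum_range_succ, mul_add, ih]; ring
  · rintro ⟨i, j⟩ hx ⟨i', j'⟩ hy hxy
    simp only [Finset.coe_sigma, Set.mem_sigma_iff, Finset.mem_coe, Finset.mem_range] at hx hy
    have h0 := DFunLike.congr_fun hxy 0
    have h1 := DFunLike.congr_fun hxy 1
    simp at h0 h1
    subst h0
    have : i = i' := by omega
    subst this
    rfl

/-- The translates are independent and as numerous as the dimension bound allows, hence they span.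
-/
theorem exists_family_sum (hA : Admissible B c h g G) {Λ : ℂ} (hΛ : Λ ≠ 0)
    (hQ : quad (cross g (G 0) (G 1)) ≠ 0) {k : ℕ} {F : Forms}
    (hF : F ∈ gluedForms (RatFunc.C (Λ * B ^ (k + 1)) * RatFunc.X⁻¹) (k + 1)) :
    ∃ f : Fin 2 × (Fin 2 →₀ ℕ) → Coeff,
      ∑ a, ∑ m ∈ lowDegree k, f (a, m) • family (Λ * B) c h g G k (a, m) = F := by
  set s : Finset (Fin 2 × (Fin 2 →₀ ℕ)) := Finset.univ ×ˢ lowDegree k with hs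
  have hind : LinearIndepOn Coeff (family (Λ * B) c h g G k) (s : Set _) :=
    family_linearIndepOn (mul_ne_zero hΛ hA.B_ne) hQ _
  obtain ⟨hfin, hle⟩ := finrank_gluedForms_le (RatFunc.C (Λ * B ^ (k + 1)) * RatFunc.X⁻¹) k
  have hspan : Submodule.span Coeff (family (Λ * B) c h g G k '' s) =
      gluedForms (RatFunc.C (Λ * B ^ (k + 1)) * RatFunc.X⁻¹) (k + 1) := by
    refine Submodule.eq_of_le_of_finrank_le (Submodule.span_le.mpr ?_) (hle.trans_eq ?_)
    · rintro _ ⟨x, hx, rfl⟩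
      exact family_mem hA Λ (lowDegree_le (Finset.mem_product.mp (Finset.mem_coe.mp hx)).2)
    · have := finrank_span_eq_card hind
      rw [← card_lowDegree, Set.image_eq_range]
      refine Eq.trans ?_ this.symm
      simp [hs]
  rw [← hspan, Finsupp.mem_span_image_iff_linearCombination] at hF
  obtain ⟨f, hfs, hf⟩ := hF
  refine ⟨f, ?_⟩
  rw [← hf, Finsupp.linearCombination_apply_of_mem_supported Coeff hfs, hs, Finset.sum_product]

/-- Two elements of a submodule are a basis if every element is a unique combination of them. -/
theorem exists_basis_of_pair {R V : Type} [Semiring R] [AddCommMonoid V] [Module R V]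
    {M : Submodule R V} {v w : V} (hv : v ∈ M) (hw : w ∈ M)
    (hind : ∀ s t s' t' : R, s • v + t • w = s' • v + t' • w → s = s' ∧ t = t')
    (hspan : ∀ x ∈ M, ∃ s t : R, s • v + t • w = x) :
    ∃ b : Module.Basis (Fin 2) R M, (b 0 : V) = v ∧ (b 1 : V) = w := by
  have hi : LinearIndependent R ![(⟨v, hv⟩ : M), ⟨w, hw⟩] :=
    LinearIndependent.pair_iffₛ.mpr fun s t s' t' h => hind s t s' t' (congrArg Subtype.val h)
  suffices hs : ⊤ ≤ Submodule.span R (Set.range ![(⟨v, hv⟩ : M), ⟨w, hw⟩]) from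
    ⟨Module.Basis.mk hi hs, by rw [Module.Basis.mk_apply]; rfl, by rw [Module.Basis.mk_apply]; rfl⟩
  rintro ⟨x, hx⟩ -
  obtain ⟨s, t, rfl⟩ := hspan x hx
  have : (⟨s • v + t • w, hx⟩ : M) = s • ⟨v, hv⟩ + t • ⟨w, hw⟩ := rfl
  rw [this]
  exact add_mem (Submodule.smul_mem _ _ (Submodule.subset_span ⟨0, rfl⟩))
    (Submodule.smul_mem _ _ (Submodule.subset_span ⟨1, rfl⟩))

theorem opOf_gen_injective (hA : Admissible B c h g G) {Λ : ℂ} (hΛ : Λ ≠ 0)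
    (hQ : quad (cross g (G 0) (G 1)) ≠ 0) {F F' : (Fin 2 →₀ ℕ) →₀ Coeff}
    (h0 : opOf c h F (sect c h g G 1 (gen (Λ * B) 0)) +
        opOf c h F' (sect c h g G 1 (gen (Λ * B) 1)) = 0) : F = 0 ∧ F' = 0 := by
  set T := F.support ∪ F'.support with hT
  have hk : ∀ m ∈ T, m 0 + m 1 ≤ T.sup fun m => m 0 + m 1 := fun m hm =>
    Finset.le_sup (f := fun m : Fin 2 →₀ ℕ => m 0 + m 1) hm
  rw [opOf_sect_gen hA _ _ Finset.subset_union_left hk,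
    opOf_sect_gen hA _ _ Finset.subset_union_right hk, ← sect_add, ← sect_zero] at h0
  have h2 := sect_injective hA _ h0
  have h3 := (linearIndepOn_finset_iff.mp
    (family_linearIndepOn (c := c) (h := h) (mul_ne_zero hΛ hA.B_ne) hQ T))
    (fun x => (![F, F'] x.1) x.2) (by
      rw [Finset.sum_product, Fin.sum_univ_two]
      exact h2)
  constructor
  · ext m : 1
    by_cases hm : m ∈ T
    · exact h3 (0, m) (Finset.mem_product.mpr ⟨Finset.mem_univ _, hm⟩)
    · exact Finsupp.notMem_support_iff.mp fun hm' => hm (Finset.mem_union_left _ hm')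
  · ext m : 1
    by_cases hm : m ∈ T
    · exact h3 (1, m) (Finset.mem_product.mpr ⟨Finset.mem_univ _, hm⟩)
    · exact Finsupp.notMem_support_iff.mp fun hm' => hm (Finset.mem_union_right _ hm')

theorem exists_opOf_gen (hA : Admissible B c h g G) {Λ : ℂ} (hΛ : Λ ≠ 0)
    (hQ : quad (cross g (G 0) (G 1)) ≠ 0) {k : ℕ} {φ : DFun} (hφ : φ ∈ modulePiece Λ c h g G k) :
    ∃ F F', opOf c h F (sect c h g G 1 (gen (Λ * B) 0)) +
        opOf c h F' (sect c h g G 1 (gen (Λ * B) 1)) = φ := by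
  -- The count concerns bidegree `(k + 1, k + 1)`; passing to the next piece also covers `k = 0`.
  have hk1 := modulePiece_mono hA Λ (Nat.le_succ k) hφ
  rw [modulePiece_eq hA] at hk1
  obtain ⟨F, hF, rfl⟩ := hk1
  obtain ⟨f, rfl⟩ := exists_family_sum hA hΛ hQ hF
  let q : Fin 2 → (Fin 2 →₀ ℕ) →₀ Coeff := fun a =>
    ∑ m ∈ lowDegree k, Finsupp.single m (f (a, m))
  have hq : ∀ a, ∀ m ∈ lowDegree k, q a m = f (a, m) := by
    intro a m hm
    simp [q, Finsupp.single_apply, hm]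
  have hqs : ∀ a, (q a).support ⊆ lowDegree k := by
    intro a m hm
    by_contra hm'
    refine Finsupp.mem_support_iff.mp hm ?_
    simp [q, Finsupp.single_apply, hm']
  refine ⟨q 0, q 1, ?_⟩
  rw [opOf_sect_gen hA _ _ (hqs 0) fun m hm => lowDegree_le hm,
    opOf_sect_gen hA _ _ (hqs 1) fun m hm => lowDegree_le hm, ← sect_add, Fin.sum_univ_two]
  congr 2 <;> exact Finset.sum_congr rfl fun m hm => by rw [hq _ m hm]

theorem freeOfRankTwo (hA : Admissible B c h g G) {Λ : ℂ} (hΛ : Λ ≠ 0)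
    (hQ : quad (cross g (G 0) (G 1)) ≠ 0) : FreeOfRankTwo Λ c h g G := by
  have hgen : ∀ a, sect c h g G 1 (gen (Λ * B) a) ∈ modulePiece Λ c h g G 1 := by
    intro a
    rw [modulePiece_eq hA]
    exact ⟨_, gen_mem_gluedForms Λ a, rfl⟩
  have hbasis := exists_basis_of_pair (M := bakerModule hA Λ)
    (Set.mem_iUnion.mpr ⟨1, hgen 0⟩) (Set.mem_iUnion.mpr ⟨1, hgen 1⟩) (by
      rintro ⟨s, hs⟩ ⟨t, ht⟩ ⟨s', hs'⟩ ⟨t', ht'⟩ h0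
      obtain ⟨S, rfl⟩ := exists_opOf_eq hs
      obtain ⟨T, rfl⟩ := exists_opOf_eq ht
      obtain ⟨S', rfl⟩ := exists_opOf_eq hs'
      obtain ⟨T', rfl⟩ := exists_opOf_eq ht'
      have h1 : opOf c h S (sect c h g G 1 (gen (Λ * B) 0)) +
          opOf c h T (sect c h g G 1 (gen (Λ * B) 1)) =
          opOf c h S' (sect c h g G 1 (gen (Λ * B) 0)) +
          opOf c h T' (sect c h g G 1 (gen (Λ * B) 1)) := h0
      obtain ⟨hS, hT⟩ := opOf_gen_injective hA hΛ hQ (F := S - S') (F' := T - T') (by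
        rw [map_sub, map_sub, LinearMap.sub_apply, LinearMap.sub_apply, sub_add_sub_comm, h1,
          sub_self])
      rw [sub_eq_zero] at hS hT
      subst hS hT
      exact ⟨rfl, rfl⟩) (by
      intro φ hφ
      obtain ⟨k, hk⟩ := Set.mem_iUnion.mp hφ
      obtain ⟨F, F', h0⟩ := exists_opOf_gen hA hΛ hQ hk
      exact ⟨⟨_, opOf_mem c h F⟩, ⟨_, opOf_mem c h F'⟩, h0⟩)
  obtain ⟨b, hb0, hb1⟩ := hbasis
  refine ⟨bakerModule hA Λ, rfl, b, Fin.forall_fin_two.mpr ⟨?_, ?_⟩⟩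
  · rw [hb0]; exact hgen 0
  · rw [hb1]; exact hgen 1

end

/-! ### Admissible values of `h` -/

theorem coeff_of_glue {p : Fin 4 → ℂ} {b : ℂ}
    (h : ∀ t₁ t₂ : ℂ, bil p 1 0 t₁ t₂ - b * bil p t₁ t₂ 0 1 = 0) :
    p 0 = b * p 1 ∧ p 1 = b * p 3 := by
  have h1 := h 1 0
  have h2 := h 0 1
  simp [bil] at h1 h2
  exact ⟨sub_eq_zero.mp h1, sub_eq_zero.mp h2⟩

/-- The derivatives at `s = 0` of a family `G` with multiplier `B exp s`. -/
theorem deriv_of_glue {B : ℂ} {G : ℂ → Fin 4 → ℂ} {G' : Fin 4 → ℂ} (hG' : HasDerivAt G G' 0)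
    (h0 : ∀ s, G s 0 = B * Complex.exp s * G s 1) (h1 : ∀ s, G s 1 = B * Complex.exp s * G s 3) :
    G' 0 = B * (G 0 1 + G' 1) ∧ G' 1 = B * (G 0 3 + G' 3) := by
  rw [hasDerivAt_pi] at hG'
  have he : HasDerivAt (fun s => B * Complex.exp s) (B * Complex.exp 0) 0 :=
    (Complex.hasDerivAt_exp 0).const_mul B
  have d0 := he.mul (hG' 1)
  have d1 := he.mul (hG' 3)
  have e0 := hG' 0
  have e1 := hG' 1
  simp only [h0] at e0
  rw [funext h1] at e1
  have r0 := e0.unique d0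
  have r1 := e1.unique d1
  simp only [Complex.exp_zero] at r0 r1
  exact ⟨by rw [r0]; ring, by rw [r1]; ring⟩

/-- The gluing relations and their derivatives make this value a nonzero multiple of the square of a
`2 × 2` minor of `g` and `G' 0 - G' 1`. -/
theorem quad_cross_ne_zero {B : ℂ} (hB : B ≠ 0) {g : Fin 4 → ℂ} {G' : Fin 2 → Fin 4 → ℂ}
    (hg : g 3 ≠ 0) (hg0 : g 0 = B * g 1) (hg1 : g 1 = B * g 3)
    (hG0 : ∀ i, G' i 0 = B * (g 1 + G' i 1)) (hG1 : ∀ i, G' i 1 = B * (g 3 + G' i 3))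
    (hind : LinearIndependent ℂ ![g, G' 0, G' 1]) : quad (cross g (G' 0) (G' 1)) ≠ 0 := by
  have hne : g 3 * (G' 0 2 - G' 1 2) - g 2 * (G' 0 3 - G' 1 3) ≠ 0 := by
    intro h
    -- In `G' 0 - G' 1` the inhomogeneous terms cancel, so it obeys the same relations as `g`. The
    -- combination `g₃ (G' 0 - G' 1) - (G' 0 - G' 1)₃ g` therefore vanishes except possibly in entry
    -- `2`, where it equals the minor.
    have := Fintype.linearIndependent_iff.mp hind ![-(G' 0 3 - G' 1 3), g 3, -g 3] (by
      simp only [Fin.sum_univ_three, Matrix.cons_val]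
      funext i
      fin_cases i
      · simp [hG0, hG1, hg0, hg1]; ring
      · simp [hG1, hg1]; ring
      · simp; linear_combination h
      · simp; ring) 1
    exact hg (by simpa using this)
  have : quad (cross g (G' 0) (G' 1)) =
      B ^ 4 * g 3 ^ 2 * (g 3 * (G' 0 2 - G' 1 2) - g 2 * (G' 0 3 - G' 1 3)) ^ 2 := by
    simp [quad, cross, hG0, hG1, hg0, hg1]
    ring
  rw [this]
  positivity

/-- The cross product is alternating and multilinear, so adding `g` to the other rows has no effect
and `t²` factors out; `quad` squares this. -/
theorem quad_cross_add_smul (g q r : Fin 4 → ℂ) (t : ℂ) :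
    quad (cross g (g + t • q) (g + t • r)) = t ^ 4 * quad (cross g q r) := by
  simp [quad, cross]
  ring

theorem continuous_quad_cross (g : Fin 4 → ℂ) :
    Continuous fun x : (Fin 4 → ℂ) × (Fin 4 → ℂ) => quad (cross g x.1 x.2) := by
  simp only [quad, cross, Matrix.cons_val]
  fun_prop

/-- Writing `G i t = g + t •` slope and dividing by `t⁴` leaves a continuous function of the slopes,
which tend to `G' i`. -/
theorem eventually_quad_cross_ne_zero {g : Fin 4 → ℂ} {G : Fin 2 → ℂ → Fin 4 → ℂ}
    {G' : Fin 2 → Fin 4 → ℂ} (hG0 : ∀ i, G i 0 = g) (hG' : ∀ i, HasDerivAt (G i) (G' i) 0)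
    (hQ : quad (cross g (G' 0) (G' 1)) ≠ 0) :
    ∀ᶠ t in 𝓝[≠] (0 : ℂ), quad (cross g (G 0 t) (G 1 t)) ≠ 0 := by
  have hs : ∀ i, Tendsto (fun t : ℂ => t⁻¹ • (G i t - g)) (𝓝[≠] 0) (𝓝 (G' i)) := by
    intro i
    have := hasDerivAt_iff_tendsto_slope_zero.mp (hG' i)
    simpa [hG0] using this
  have hlim := ((continuous_quad_cross g).tendsto (G' 0, G' 1)).comp ((hs 0).prodMk_nhds (hs 1))
  filter_upwards [hlim.eventually_ne hQ, self_mem_nhdsWithin] with t ht ht0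
  have ht0 : t ≠ 0 := ht0
  have hr : ∀ i, G i t = g + t • (t⁻¹ • (G i t - g)) := by
    intro i
    rw [smul_inv_smul₀ ht0]
    abel
  rw [hr 0, hr 1, quad_cross_add_smul]
  exact mul_ne_zero (pow_ne_zero 4 ht0) ht

theorem not_countable_of_mem_nhdsNE {S : Set ℂ} (hS : S ∈ 𝓝[≠] (0 : ℂ)) : ¬ S.Countable := by
  intro hc
  have h1 : insert 0 S ∈ 𝓝 (0 : ℂ) := by
    rw [mem_nhdsWithin_iff_eventually] at hS
    filter_upwards [hS] with t ht
    by_cases h0 : t = 0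
    · exact Or.inl h0
    · exact Or.inr (ht h0)
  have h2 := cardinal_eq_of_mem_nhds ℂ h1
  have h3 := (hc.insert 0).le_aleph0
  rw [h2, Cardinal.mk_complex] at h3
  exact absurd h3 (not_le.mpr Cardinal.aleph0_lt_continuum)

end DBA

end

theorem theorem3 (B Λ : ℂ) (hB : B ≠ 0) (hΛ : Λ ≠ 0) (c : Fin 2 → ℂ) (hc : ∀ i, c i ≠ 0)
    -- the function `g`
    (g : Fin 4 → ℂ) (hg : DBA.bil g (0 : ℂ) 1 0 1 ≠ 0)
    (hgB : ∀ t₁ t₂ : ℂ, DBA.bil g 1 0 t₁ t₂ - B * DBA.bil g t₁ t₂ 0 1 = 0)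
    -- the families `Gᵢ(·, s)` through `g` and their derivatives at `s = 0`
    (G : Fin 2 → ℂ → Fin 4 → ℂ) (G' : Fin 2 → Fin 4 → ℂ)
    (hGB : ∀ i, ∀ s t₁ t₂ : ℂ,
      DBA.bil (G i s) 1 0 t₁ t₂ - B * Complex.exp s * DBA.bil (G i s) t₁ t₂ 0 1 = 0)
    (hG0 : ∀ i, G i 0 = g)
    (hG' : ∀ i, HasDerivAt (G i) (G' i) 0)
    (hind : LinearIndependent ℂ ![g, G' 0, G' 1]) :
    ¬ Set.Countable {h : Fin 2 → ℂ | (∀ i, h i ≠ 0) ∧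
      (∀ i, DBA.bil (G i (c i * h i)) (0 : ℂ) 1 0 1 ≠ 0) ∧
      DBA.FreeOfRankTwo Λ c h g (fun i => G i (c i * h i))} := by
  have hg3 : g 3 ≠ 0 := by simpa [DBA.bil] using hg
  obtain ⟨hg0, hg1⟩ := DBA.coeff_of_glue hgB
  have hcoef : ∀ i s, G i s 0 = B * Complex.exp s * G i s 1 ∧ G i s 1 = B * Complex.exp s * G i s 3 :=
    fun i s => DBA.coeff_of_glue (hGB i s)
  have hder := fun i => DBA.deriv_of_glue (hG' i) (fun s => (hcoef i s).1) (fun s => (hcoef i s).2)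
  simp only [hG0] at hder
  have hQ := DBA.eventually_quad_cross_ne_zero hG0 hG' (DBA.quad_cross_ne_zero hB hg3 hg0 hg1
    (fun i => (hder i).1) (fun i => (hder i).2) hind)
  have h3 : ∀ i, ∀ᶠ t in nhdsWithin (0 : ℂ) {0}ᶜ, G i t 3 ≠ 0 := by
    intro i
    have hcont := (hasDerivAt_pi.mp (hG' i) 3).continuousAt
    exact (hcont.eventually_ne (by simpa only [hG0] using hg3)).filter_mono nhdsWithin_le_nhds
  -- The curve `h = (t / c 0, t / c 1)` makes both parameters `c i * h i` equal to `t`. It is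
  -- injective, so a countable set of good `h` would give a countable punctured neighbourhood of
  -- `0`.
  have hinj : Function.Injective fun (t : ℂ) (i : Fin 2) => t / c i := fun t t' h =>
    (div_left_inj' (hc 0)).mp (congrFun h 0)
  intro hcount
  refine DBA.not_countable_of_mem_nhdsNE ?_ (hcount.preimage hinj)
  filter_upwards [hQ, Filter.eventually_all.mpr h3, self_mem_nhdsWithin] with t hQt ht3 ht0
  have hci : ∀ i, c i * (t / c i) = t := fun i => mul_div_cancel₀ t (hc i)
  simp only [Set.mem_preimage, Set.mem_ofPred_eq, hci]
  refine ⟨fun i => div_ne_zero ht0 (hc i), fun i => by simpa [DBA.bil] using ht3 i, ?_⟩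
  refine DBA.freeOfRankTwo (B := B) ⟨hB, hg3, ht3, hg0, hg1, ?_, ?_⟩ hΛ hQt
  · intro j; rw [hci]; exact (hcoef j t).1
  · intro j; rw [hci]; exact (hcoef j t).2
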